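/- There is an absolute constant $c$ such that the following holds for all even $n$ and all $d\ge 1$. Let $C$ be an $n$-qubit quantum circuit with gates from $\{\mathrm X,\mathrm Z,\mathrm H,\mathrm P,\mathrm{CNOT},\mathrm T\}$, where $\mathrm P=\mathrm{diag}(1,i)$ and $\mathrm T=\mathrm{diag}(1,e^{i\pi/4})$, and let $C$ have T-depth $d$, i.e. $d$ is the number of layers of $\mathrm T$ gates when the circuit is viewed as alternating between Clifford gates and layers of simultaneous $\mathrm T$ gates (the smallest number of such layers, over all orders in which the gates of the circuit diagram can be listed). Let Alice hold $n/2$ of the $n$ qubits and Bob the other $n/2$. Then there exists an instantaneous non-local quantum protocol that performs the operation $\rho\mapsto U_C\,\rho\,U_C^\dagger$ exactly, where $U_C$ is the unitary of $C$, and whose pre-shared entangled state consists of at most $c\,(68n)^d$ EPR pairs; that is, $O((68n)^d)$ EPR pairs. In particular $\mathrm{INQC}(C)\le c\,(68n)^d$. Here an instantaneous non-local quantum protocol using $k$ qubits of entanglement is the following: Alice and Bob share a fixed pure state in $\mathbb C^{2^k}\otimes\mathbb C^{2^k}$; each applies a quantum operation (completely positive trace-preserving map) to his or her part of the input and of the shared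 state, producing a register to keep and a register to send; the sent registers are exchanged simultaneously, once; then each applies a quantum operation to the kept register and the received register, and outputs the result ($n/2$ qubits each). $\mathrm{INQC}(C)$ is the smallest $k$ for which such a protocol performs $\rho\mapsto U_C\,\rho\,U_C^\dagger$ without error. -/

import Mathlib

open scoped Matrix Kronecker ComplexOrder

noncomputable section

/-! ### Clifford+T circuits -/

/-- The computational basis states of a register of qubits with set of wires `W`. -/
abbrev Qubits (W : Type) : Type := W → Fin 2

/-- The elementary gates on the wires `W`: Pauli X and Z, Hadamard, phase gate P,
CNOT (first argument: control, second argument: target), and the T gate. -/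
inductive Gate (W : Type) : Type
  | X (w : W) : Gate W
  | Z (w : W) : Gate W
  | H (w : W) : Gate W
  | P (w : W) : Gate W
  | CNOT (c t : W) (hct : c ≠ t) : Gate W
  | T (w : W) : Gate W

/-- The set of wires on which a gate acts. -/
def Gate.wires {W : Type} : Gate W → Set W
  | .X w => {w}
  | .Z w => {w}
  | .H w => {w}
  | .P w => {w}
  | .CNOT c t _ => {c, t}
  | .T w => {w}

/-- All gates other than the T gate are Clifford gates. -/
def Gate.IsClifford {W : Type} : Gate W → Prop
  | .T _ => False
  | _ => True

/-- The single-qubit operation `M` applied to wire `w` (identity on all other wires). -/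
def onWire {W : Type} [Fintype W] [DecidableEq W] (w : W) (M : Matrix (Fin 2) (Fin 2) ℂ) :
    Matrix (Qubits W) (Qubits W) ℂ :=
  Matrix.of fun x y => if ∀ v, v ≠ w → x v = y v then M (x w) (y w) else 0

/-- The matrix of a gate. A CNOT sends the basis state `y` to the basis state in which the
target bit is replaced by its sum mod 2 with the control bit. -/
def Gate.matrix {W : Type} [Fintype W] [DecidableEq W] :
    Gate W → Matrix (Qubits W) (Qubits W) ℂ
  | .X w => onWire w !![0, 1; 1, 0]
  | .Z w => onWire w !![1, 0; 0, -1]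
  | .H w => onWire w (((Real.sqrt 2 : ℝ) : ℂ)⁻¹ • !![1, 1; 1, -1])
  | .P w => onWire w !![1, 0; 0, Complex.I]
  | .CNOT c t _ =>
      Matrix.of fun x y => if x = Function.update y t (y t + y c) then 1 else 0
  | .T w => onWire w !![1, 0; 0, Complex.exp (Complex.I * Real.pi / 4)]

/-- A circuit is a sequence of gates; the head of the list is applied first. -/
abbrev Circuit (W : Type) : Type := List (Gate W)

/-- The unitary matrix implemented by a circuit. -/
def Circuit.unitary {W : Type} [Fintype W] [DecidableEq W] :
    Circuit W → Matrix (Qubits W) (Qubits W) ℂ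
  | [] => 1
  | g :: C => Circuit.unitary C * g.matrix

/-- Two gate sequences differ by exchanging two neighbouring gates on disjoint sets of wires. -/
inductive Circuit.Swap {W : Type} : Circuit W → Circuit W → Prop
  | mk (C D : Circuit W) (g h : Gate W) (hgh : Disjoint g.wires h.wires) :
      Circuit.Swap (C ++ g :: h :: D) (C ++ h :: g :: D)

/-- Two gate sequences describe the same circuit (the same circuit diagram): they differ only in
the order in which gates on disjoint sets of wires are listed. -/
def Circuit.Same {W : Type} : Circuit W → Circuit W → Prop :=
  Relation.EqvGen Circuit.Swap

/-- `Circuit.HasLayers d C`: the gate sequence `C` has the form `C₀ T₁ C₁ T₂ C₂ ⋯ T_d C_d` where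
the `Cᵢ` consist of Clifford gates only and each `Tᵢ` is a layer of simultaneous T gates, i.e.
T gates on distinct wires. -/
inductive Circuit.HasLayers {W : Type} : ℕ → Circuit W → Prop
  | clifford (C : Circuit W) (hC : ∀ g ∈ C, g.IsClifford) : Circuit.HasLayers 0 C
  | layer (d : ℕ) (C : Circuit W) (S : List W) (K : Circuit W)
      (hC : Circuit.HasLayers d C) (hS : S.Nodup) (hK : ∀ g ∈ K, g.IsClifford) :
      Circuit.HasLayers (d + 1) (C ++ S.map Gate.T ++ K)

/-- The T-depth of a circuit: the number of layers of T gates, when the circuit is viewed as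
alternating between Clifford gates and layers of simultaneous T gates. -/
def Circuit.tDepth {W : Type} (C : Circuit W) : ℕ :=
  sInf {d | ∃ C' : Circuit W, Circuit.Same C C' ∧ Circuit.HasLayers d C'}

/-! ### Quantum operations -/

/-- The tensor product `Φ ⊗ Ψ` of two linear maps on matrices. -/
def tensorMap {a a' b b' : Type} (Φ : Matrix a a ℂ →ₗ[ℂ] Matrix a' a' ℂ)
    (Ψ : Matrix b b ℂ →ₗ[ℂ] Matrix b' b' ℂ) :
    Matrix (a × b) (a × b) ℂ →ₗ[ℂ] Matrix (a' × b') (a' × b') ℂ where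
  toFun ρ := Matrix.of fun p q =>
    Φ (Matrix.of fun i j => Ψ (Matrix.of fun k l => ρ (i, k) (j, l)) p.2 q.2) p.1 q.1
  map_add' ρ σ := by
    ext p q
    have h1 : ∀ i j, (Matrix.of fun k l => (ρ + σ) (i, k) (j, l))
        = (Matrix.of fun k l => ρ (i, k) (j, l)) + (Matrix.of fun k l => σ (i, k) (j, l)) := by
      intro i j; rfl
    have h2 : (Matrix.of fun i j => Ψ (Matrix.of fun k l => (ρ + σ) (i, k) (j, l)) p.2 q.2)
        = (Matrix.of fun i j => Ψ (Matrix.of fun k l => ρ (i, k) (j, l)) p.2 q.2)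
          + (Matrix.of fun i j => Ψ (Matrix.of fun k l => σ (i, k) (j, l)) p.2 q.2) := by
      ext i j
      rw [Matrix.add_apply, Matrix.of_apply, h1 i j, map_add, Matrix.add_apply]
      rfl
    rw [Matrix.add_apply, Matrix.of_apply, h2, map_add, Matrix.add_apply]
    rfl
  map_smul' c ρ := by
    ext p q
    have h1 : ∀ i j, (Matrix.of fun k l => (c • ρ) (i, k) (j, l))
        = c • (Matrix.of fun k l => ρ (i, k) (j, l)) := by
      intro i j; rfl
    have h2 : (Matrix.of fun i j => Ψ (Matrix.of fun k l => (c • ρ) (i, k) (j, l)) p.2 q.2)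
        = c • (Matrix.of fun i j => Ψ (Matrix.of fun k l => ρ (i, k) (j, l)) p.2 q.2) := by
      ext i j
      rw [Matrix.smul_apply, Matrix.of_apply, h1 i j, map_smul, Matrix.smul_apply]
      rfl
    rw [RingHom.id_apply, Matrix.smul_apply, Matrix.of_apply, h2, map_smul, Matrix.smul_apply]
    rfl

/-- On product operators, `Φ ⊗ Ψ` acts as expected. -/
theorem tensorMap_kronecker {a a' b b' : Type} (Φ : Matrix a a ℂ →ₗ[ℂ] Matrix a' a' ℂ)
    (Ψ : Matrix b b ℂ →ₗ[ℂ] Matrix b' b' ℂ) (A : Matrix a a ℂ) (B : Matrix b b ℂ) :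
    tensorMap Φ Ψ (A ⊗ₖ B) = Φ A ⊗ₖ Ψ B := by
  ext p q
  have h1 : ∀ i j, (Matrix.of fun k l => (A ⊗ₖ B) (i, k) (j, l)) = A i j • B := by
    intro i j; ext k l; simp [Matrix.kroneckerMap_apply]
  have h2 : (Matrix.of fun i j => Ψ (Matrix.of fun k l => (A ⊗ₖ B) (i, k) (j, l)) p.2 q.2)
      = Ψ B p.2 q.2 • A := by
    ext i j
    simp only [Matrix.of_apply, h1 i j, map_smul, Matrix.smul_apply, smul_eq_mul, mul_comm]
  change Φ (Matrix.of fun i j => Ψ (Matrix.of fun k l => (A ⊗ₖ B) (i, k) (j, l)) p.2 q.2)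
    p.1 q.1 = _
  rw [h2, map_smul, Matrix.smul_apply, smul_eq_mul, Matrix.kroneckerMap_apply, mul_comm]

/-- Complete positivity: `id ⊗ Φ` preserves positive semidefiniteness, for every finite-dimensional
ancillary system. -/
def IsCompletelyPositive {a b : Type} [Fintype a] [Fintype b]
    (Φ : Matrix a a ℂ →ₗ[ℂ] Matrix b b ℂ) : Prop :=
  ∀ (r : ℕ) (ρ : Matrix (Fin r × a) (Fin r × a) ℂ), ρ.PosSemidef →
    (tensorMap (LinearMap.id : Matrix (Fin r) (Fin r) ℂ →ₗ[ℂ] Matrix (Fin r) (Fin r) ℂ)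
      Φ ρ).PosSemidef

/-- A quantum operation: a completely positive trace-preserving map. -/
structure IsQuantumOperation {a b : Type} [Fintype a] [Fintype b]
    (Φ : Matrix a a ℂ →ₗ[ℂ] Matrix b b ℂ) : Prop where
  completelyPositive : IsCompletelyPositive Φ
  tracePreserving : ∀ ρ, (Φ ρ).trace = ρ.trace

/-- The operation `ρ ↦ U ρ U†`. -/
def conjMap {a : Type} [Fintype a] (U : Matrix a a ℂ) : Matrix a a ℂ →ₗ[ℂ] Matrix a a ℂ where
  toFun ρ := U * ρ * Uᴴ
  map_add' ρ σ := by rw [Matrix.mul_add, Matrix.add_mul]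
  map_smul' c ρ := by rw [Matrix.mul_smul, Matrix.smul_mul, RingHom.id_apply]

/-! ### Instantaneous non-local quantum computation -/

/-- The amplitudes of one EPR pair `(|00⟩ + |11⟩) / √2`. -/
def eprPair (x y : Fin 2) : ℂ := if x = y then ((Real.sqrt 2 : ℝ) : ℂ)⁻¹ else 0

/-- The tensor product of `k` EPR pairs; one half of each pair belongs to the first register. -/
def eprPairs (k : ℕ) (p : Qubits (Fin k) × Qubits (Fin k)) : ℂ :=
  ∏ i, eprPair (p.1 i) (p.2 i)

/-- An instantaneous non-local quantum protocol that uses `k` qubits of entanglement. All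
registers are finite-dimensional and given by their computational basis:
`Am` (`Bm`) is what Alice (Bob) keeps, `As` (`Bs`) is what Alice (Bob) sends. -/
structure INQCProtocol (k : ℕ) (Ain Bin Aout Bout : Type)
    [Fintype Ain] [Fintype Bin] [Fintype Aout] [Fintype Bout] where
  /-- the shared entangled state, first factor held by Alice, second factor by Bob -/
  resource : Qubits (Fin k) × Qubits (Fin k) → ℂ
  resource_unit : ∑ p, ‖resource p‖ ^ 2 = 1
  Am : Type
  As : Type
  Bm : Type
  Bs : Type
  [fintypeAm : Fintype Am]
  [fintypeAs : Fintype As]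
  [fintypeBm : Fintype Bm]
  [fintypeBs : Fintype Bs]
  /-- the operations of the players before the communication -/
  A₁ : Matrix (Ain × Qubits (Fin k)) (Ain × Qubits (Fin k)) ℂ →ₗ[ℂ] Matrix (Am × As) (Am × As) ℂ
  B₁ : Matrix (Bin × Qubits (Fin k)) (Bin × Qubits (Fin k)) ℂ →ₗ[ℂ] Matrix (Bm × Bs) (Bm × Bs) ℂ
  /-- the operations of the players after the simultaneous exchange of messages -/
  A₂ : Matrix (Am × Bs) (Am × Bs) ℂ →ₗ[ℂ] Matrix Aout Aout ℂ
  B₂ : Matrix (Bm × As) (Bm × As) ℂ →ₗ[ℂ] Matrix Bout Bout ℂ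
  isQuantumOperation_A₁ : IsQuantumOperation A₁
  isQuantumOperation_B₁ : IsQuantumOperation B₁
  isQuantumOperation_A₂ : IsQuantumOperation A₂
  isQuantumOperation_B₂ : IsQuantumOperation B₂

/-- The output of a protocol on the bipartite input `ρ`: the input and the shared state are
distributed, the first operations are applied, the message registers are exchanged, and the second
operations are applied. -/
def INQCProtocol.output {k : ℕ} {Ain Bin Aout Bout : Type}
    [Fintype Ain] [Fintype Bin] [Fintype Aout] [Fintype Bout]
    (P : INQCProtocol k Ain Bin Aout Bout) (ρ : Matrix (Ain × Bin) (Ain × Bin) ℂ) :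
    Matrix (Aout × Bout) (Aout × Bout) ℂ :=
  let start := (ρ ⊗ₖ Matrix.vecMulVec P.resource (star P.resource)).submatrix
    (fun p : (Ain × Qubits (Fin k)) × (Bin × Qubits (Fin k)) =>
      ((p.1.1, p.2.1), (p.1.2, p.2.2)))
    (fun p : (Ain × Qubits (Fin k)) × (Bin × Qubits (Fin k)) =>
      ((p.1.1, p.2.1), (p.1.2, p.2.2)))
  let exchanged := (tensorMap P.A₁ P.B₁ start).submatrix
    (fun p : (P.Am × P.Bs) × (P.Bm × P.As) => ((p.1.1, p.2.2), (p.2.1, p.1.2)))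
    (fun p : (P.Am × P.Bs) × (P.Bm × P.As) => ((p.1.1, p.2.2), (p.2.1, p.1.2)))
  tensorMap P.A₂ P.B₂ exchanged

/-- The protocol performs the bipartite operation `Φ` exactly. -/
def INQCProtocol.Performs {k : ℕ} {Ain Bin Aout Bout : Type}
    [Fintype Ain] [Fintype Bin] [Fintype Aout] [Fintype Bout]
    (P : INQCProtocol k Ain Bin Aout Bout)
    (Φ : Matrix (Ain × Bin) (Ain × Bin) ℂ →ₗ[ℂ] Matrix (Aout × Bout) (Aout × Bout) ℂ) : Prop :=
  ∀ ρ, P.output ρ = Φ ρ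

/-- `INQC Φ`: the smallest `k` such that some protocol that uses `k` qubits of entanglement
performs `Φ` without error (`⊤` if there is none). -/
def INQC {Ain Bin Aout Bout : Type}
    [Fintype Ain] [Fintype Bin] [Fintype Aout] [Fintype Bout]
    (Φ : Matrix (Ain × Bin) (Ain × Bin) ℂ →ₗ[ℂ] Matrix (Aout × Bout) (Aout × Bout) ℂ) : ℕ∞ :=
  ⨅ k ∈ {k : ℕ | ∃ P : INQCProtocol k Ain Bin Aout Bout, P.Performs Φ}, (k : ℕ∞)

/-- The bipartite operation `ρ ↦ U ρ U†` of a circuit on `m + m` wires, of which the left `m` wires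
belong to Alice and the right `m` wires belong to Bob. -/
def Circuit.bipartiteMap {m : ℕ} (C : Circuit (Fin m ⊕ Fin m)) :
    Matrix (Qubits (Fin m) × Qubits (Fin m)) (Qubits (Fin m) × Qubits (Fin m)) ℂ →ₗ[ℂ]
      Matrix (Qubits (Fin m) × Qubits (Fin m)) (Qubits (Fin m) × Qubits (Fin m)) ℂ :=
  conjMap (C.unitary.submatrix
    (fun p : Qubits (Fin m) × Qubits (Fin m) => Sum.elim p.1 p.2)
    (fun p : Qubits (Fin m) × Qubits (Fin m) => Sum.elim p.1 p.2))

end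

open scoped Matrix Kronecker ComplexOrder

/-! ### Pauli matrices -/

/-! Bob teleports his half of the input to Alice, who runs the whole circuit on a state masked by a
Pauli error, the key, which depends on the outcomes `x` of Alice and `y` of Bob. Clifford gates act
additively on the key (`Gate.exists_addMonoidHom`). A T gate turns X^a Z^b into P^a X^a Z^b up to
phase, so P⁻¹ has to be applied exactly when a = 1, although in general neither player knows a.

The bit a is therefore computed by moving lines. A bit f is a `ComputableBit` if a product of
permutations, each chosen by one player, exchanges two distinguished lines exactly when f = 1.
Alice's permutations are local and free; each of Bob's costs a teleportation of all lines to him and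
back, 2|Λ| pairs. The qubit starts on `ι 0`, arrives on `ι f`, Alice applies P⁻¹ to `ι 1` whatever f
is, and the inverse product brings it back (`Scheme.exists_phaseInv`). Nothing is communicated
meanwhile: teleportation errors stay uncorrected and operations of different players commute, so
everything is one measurement of a shared maximally entangled state, a `Scheme`.

The new error is the sum of the Paulis met along the path, plus a Z caused by moving X past P⁻¹. It
is computable again: attach a Pauli label to each line, and let the same product of permutations add
the errors to the label (`twist`, `Scheme.exists_run`, `computableBit_error`).

Count with n = 2m. A T gate costs 4|Λ|r pairs and leads from |Λ| lines and r rounds to 4|Λ| lines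
and 5r rounds. Clifford gates mix the 2n key bits, whence r becomes 10nr per layer. All gates of a
layer use the key from before the layer, so only the depth enters the exponent. With |Λ| = 2·4^t and
r = (10n)^t, layer t + 1 costs at most 8n(40n)^t, and `Scheme.pairs_le` bounds the total by (68n)^d.

In the single exchange Alice sends Bob's qubits and `x`, Bob sends `y`, and both undo the key. Every
pair of outcomes contributes a multiple of UρU†, and completeness makes the weights add up to 1
(`Scheme.toProtocol_performs`). -/

/-- The sign `(-1)^b`. -/
def bitSign (b : Fin 2) : ℂ := if b = 0 then 1 else -1

theorem bitSign_add (a b : Fin 2) : bitSign (a + b) = bitSign a * bitSign b := by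
  fin_cases a <;> fin_cases b <;> simp [bitSign]

/-- The Pauli matrix `X^a Z^b`. -/
def pauli (p : Fin 2 × Fin 2) : Matrix (Fin 2) (Fin 2) ℂ :=
  Matrix.of fun s r => if s = r + p.1 then bitSign (p.2 * r) else 0

theorem pauli_zero : pauli 0 = 1 := by
  ext i j; fin_cases i <;> fin_cases j <;> simp [pauli, bitSign]

theorem pauli_mul (p q : Fin 2 × Fin 2) :
    pauli p * pauli q = bitSign (p.2 * q.1) • pauli (p + q) := by
  obtain ⟨a, b⟩ := p
  obtain ⟨a', b'⟩ := q
  ext i j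
  fin_cases a <;> fin_cases b <;> fin_cases a' <;> fin_cases b' <;> fin_cases i <;>
    fin_cases j <;> simp [pauli, bitSign, Matrix.mul_apply]

theorem pauli_conjTranspose_mul (p : Fin 2 × Fin 2) : (pauli p)ᴴ * pauli p = 1 := by
  obtain ⟨a, b⟩ := p
  ext i j
  fin_cases a <;> fin_cases b <;> fin_cases i <;>
    fin_cases j <;> simp [pauli, bitSign, Matrix.mul_apply]

theorem sum_star_pauli_mul (i j i' j' : Fin 2) :
    ∑ p, star (pauli p i j) * pauli p i' j' = if i = i' ∧ j = j' then 2 else 0 := by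
  fin_cases i <;> fin_cases j <;> fin_cases i' <;>
    fin_cases j' <;> simp [pauli, bitSign, Fintype.sum_prod_type] <;> norm_num

/-! ### Operations that permute lines and act on each line separately -/

section lineMap

variable {Λ : Type} [Fintype Λ]

/-- The operator that applies `M l` to the qubit on line `l` and moves it to line `π l`. -/
def lineMap (π : Equiv.Perm Λ) (M : Λ → Matrix (Fin 2) (Fin 2) ℂ) :
    Matrix (Qubits Λ) (Qubits Λ) ℂ :=
  Matrix.of fun s r => ∏ l, M l (s (π l)) (r l)

theorem lineMap_mul [DecidableEq Λ] (π' π : Equiv.Perm Λ)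
    (M' M : Λ → Matrix (Fin 2) (Fin 2) ℂ) :
    lineMap π' M' * lineMap π M = lineMap (π' * π) (fun l => M' (π l) * M l) := by
  ext s r
  simp only [lineMap, Matrix.mul_apply, Matrix.of_apply, Finset.prod_univ_sum]
  rw [Fintype.piFinset_univ]
  refine Fintype.sum_equiv (Equiv.arrowCongr π.symm (Equiv.refl _)) _ _ fun t => ?_
  rw [← Equiv.prod_comp π, ← Finset.prod_mul_distrib]
  rfl

theorem lineMap_smul (π : Equiv.Perm Λ) (c : Λ → ℂ) (M : Λ → Matrix (Fin 2) (Fin 2) ℂ) :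
    lineMap π (fun l => c l • M l) = (∏ l, c l) • lineMap π M := by
  ext s r
  simp [lineMap, Finset.prod_mul_distrib]

theorem lineMap_one : lineMap (1 : Equiv.Perm Λ) (fun _ => 1) = 1 := by
  ext s r
  simp only [lineMap, Matrix.of_apply, Matrix.one_apply, Equiv.Perm.coe_one, id_eq]
  by_cases h : s = r
  · simp [h]
  · rw [if_neg h]
    obtain ⟨l, hl⟩ := Function.ne_iff.1 h
    exact Finset.prod_eq_zero (Finset.mem_univ l) (by simp [hl])

theorem lineMap_conjTranspose_mul [DecidableEq Λ] (π : Equiv.Perm Λ)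
    (M : Λ → Matrix (Fin 2) (Fin 2) ℂ)
    (hM : ∀ l, (M l)ᴴ * M l = 1) : (lineMap π M)ᴴ * lineMap π M = 1 := by
  have h : (lineMap π M)ᴴ = lineMap π⁻¹ (fun l => (M (π⁻¹ l))ᴴ) := by
    ext s r
    simp only [lineMap, Matrix.conjTranspose_apply, Matrix.of_apply, star_prod]
    symm
    rw [← Equiv.prod_comp π]
    simp
  rw [h, lineMap_mul]
  simp [hM, lineMap_one]

/-- The tensor product of Pauli matrices given by `p`. -/
def pauliOn (p : Λ → Fin 2 × Fin 2) : Matrix (Qubits Λ) (Qubits Λ) ℂ :=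
  lineMap 1 (fun l => pauli (p l))

/-- Paulis multiply up to sign. The scalar may be forgotten, here and in all later statements,
because it depends on the outcomes only and is recovered at the end from completeness. -/
theorem lineMap_pauli_mul [DecidableEq Λ] (π' π : Equiv.Perm Λ) (p' p : Λ → Fin 2 × Fin 2) :
    ∃ c : ℂ, lineMap π' (fun l => pauli (p' l)) * lineMap π (fun l => pauli (p l)) =
      c • lineMap (π' * π) (fun l => pauli (p' (π l) + p l)) := by
  simp only [lineMap_mul, pauli_mul]
  exact ⟨_, lineMap_smul _ _ _⟩

theorem pauliOn_conjTranspose_mul [DecidableEq Λ] (p : Λ → Fin 2 × Fin 2) :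
    (pauliOn p)ᴴ * pauliOn p = 1 :=
  lineMap_conjTranspose_mul _ _ fun _ => pauli_conjTranspose_mul _

theorem pauliOn_zero : pauliOn (0 : Λ → Fin 2 × Fin 2) = 1 := by
  simp [pauliOn, pauli_zero, lineMap_one]

/-- The sum factors over the lines into the one-qubit orthogonality relation. This makes Pauli
measurements on all lines at once, composed with a permutation, a complete teleportation
measurement. -/
theorem sum_star_lineMap_pauli_mul [DecidableEq Λ] (π : Equiv.Perm Λ) (s r s' r' : Qubits Λ) :
    ∑ p : Λ → Fin 2 × Fin 2, star (lineMap π (fun l => pauli (p l)) s r) *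
      lineMap π (fun l => pauli (p l)) s' r' =
      if s = s' ∧ r = r' then (Fintype.card (Qubits Λ) : ℂ) else 0 := by
  simp only [lineMap, Matrix.of_apply, star_prod, ← Finset.prod_mul_distrib]
  have h := Finset.prod_univ_sum (fun _ : Λ => (Finset.univ : Finset (Fin 2 × Fin 2)))
    (fun l p => star (pauli p (s (π l)) (r l)) * pauli p (s' (π l)) (r' l))
  rw [Fintype.piFinset_univ] at h
  rw [← h]
  simp only [sum_star_pauli_mul]
  by_cases hs : s = s' ∧ r = r'
  · simp [hs]
  · rw [if_neg hs]
    have : ∃ l, ¬ (s (π l) = s' (π l) ∧ r l = r' l) := by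
      by_contra! hc
      exact hs ⟨funext fun l => by simpa using (hc (π.symm l)).1, funext fun l => (hc l).2⟩
    obtain ⟨l, hl⟩ := this
    exact Finset.prod_eq_zero (Finset.mem_univ l) (if_neg hl)

end lineMap

/-! ### Permutations built from Alice's and Bob's local permutations -/

/-- `AlternatingPerm r π`: the permutation `π x y` of the lines `Λ` is a product of permutations
that depend on `x` only and of `r` permutations that depend on `y` only. -/
inductive AlternatingPerm {X Y Λ : Type} : ℕ → (X → Y → Equiv.Perm Λ) → Prop
  | alice (σ : X → Equiv.Perm Λ) : AlternatingPerm 0 (fun x _ => σ x)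
  | bob (τ : Y → Equiv.Perm Λ) : AlternatingPerm 1 (fun _ y => τ y)
  | mul {r r' : ℕ} {π π' : X → Y → Equiv.Perm Λ} (h : AlternatingPerm r π)
      (h' : AlternatingPerm r' π') : AlternatingPerm (r + r') (fun x y => π x y * π' x y)

namespace AlternatingPerm

variable {X Y X' Y' Λ Λ' : Type} {r r' : ℕ} {π : X → Y → Equiv.Perm Λ}

theorem comp (h : AlternatingPerm r π) (px : X' → X) (py : Y' → Y) :
    AlternatingPerm r (fun x y => π (px x) (py y)) := by
  induction h with
  | alice σ => exact alice (fun x => σ (px x))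
  | bob τ => exact bob (fun y => τ (py y))
  | mul _ _ ih ih' => exact mul ih ih'

theorem map (h : AlternatingPerm r π) (φ : Equiv.Perm Λ →* Equiv.Perm Λ') :
    AlternatingPerm r (fun x y => φ (π x y)) := by
  induction h with
  | alice σ => exact alice (fun x => φ (σ x))
  | bob τ => exact bob (fun y => φ (τ y))
  | mul _ _ ih ih' => simpa using mul ih ih'

theorem inv (h : AlternatingPerm r π) : AlternatingPerm r (fun x y => (π x y)⁻¹) := by
  induction h with
  | alice σ => exact alice (fun x => (σ x)⁻¹)
  | bob τ => exact bob (fun y => (τ y)⁻¹)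
  | mul _ _ ih ih' => simpa [add_comm] using mul ih' ih

theorem mono (h : AlternatingPerm r π) (hr : r ≤ r') : AlternatingPerm r' π := by
  induction hr with
  | refl => exact h
  | step _ ih => simpa using mul ih (bob 1)

end AlternatingPerm

/-! ### Recording an error along the path of a line by a label in a group -/

/-- The permutation of `Λ × G` that acts as `π` on `Λ` and adds `t l` to the second component. -/
def twist {Λ G : Type} [AddCommGroup G] (π : Equiv.Perm Λ) (t : Λ → G) : Equiv.Perm (Λ × G) where
  toFun p := (π p.1, p.2 + t p.1)
  invFun p := (π⁻¹ p.1, p.2 - t (π⁻¹ p.1))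
  left_inv p := by simp
  right_inv p := by simp

section twist

variable {Λ G : Type} [AddCommGroup G]

@[simp] theorem twist_apply (π : Equiv.Perm Λ) (t : Λ → G) (l : Λ) (g : G) :
    twist π t (l, g) = (π l, g + t l) := rfl

/-- The second summand is read at the position already reached. Pauli errors accumulate by the same
rule, compare `lineMap_pauli_mul`. -/
theorem twist_mul (π' π : Equiv.Perm Λ) (t' t : Λ → G) :
    twist π' t' * twist π t = twist (π' * π) (fun l => t' (π l) + t l) := by
  ext ⟨l, g⟩
  · rfl
  · exact (add_assoc _ _ _).trans (congrArg _ (add_comm _ _))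

/-- The action of the permutations of `Λ` on the first component of `Λ × G`. -/
def liftPerm (Λ G : Type) [AddCommGroup G] : Equiv.Perm Λ →* Equiv.Perm (Λ × G) where
  toFun π := twist π 0
  map_one' := by ext ⟨l, g⟩ <;> simp
  map_mul' π π' := by rw [twist_mul]; simp; rfl

end twist

/-- Some permutation takes any two distinct points to any two distinct points. -/
theorem exists_perm_comp_eq {Λ : Type} {ι κ : Fin 2 → Λ} (hι : Function.Injective ι)
    (hκ : Function.Injective κ) : ∃ σ : Equiv.Perm Λ, ∀ b, σ (ι b) = κ b := by
  classical
  have h1 : ι 1 ≠ ι 0 := fun h => by simpa using hι h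
  have h2 : κ 1 ≠ κ 0 := fun h => by simpa using hκ h
  refine ⟨Equiv.swap (Equiv.swap (ι 0) (κ 0) (ι 1)) (κ 1) * Equiv.swap (ι 0) (κ 0), ?_⟩
  intro b
  fin_cases b
  · simp only [Equiv.Perm.mul_apply, Fin.zero_eta, Equiv.swap_apply_left]
    refine Equiv.swap_apply_of_ne_of_ne (fun h => h1 ?_) h2.symm
    exact (Equiv.swap (ι 0) (κ 0)).injective (by rw [← h, Equiv.swap_apply_left])
  · simp

/-- `ComputableBit Λ r f`: the bit `f x y` is computed by an alternating permutation of the lines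
`Λ` with `r` rounds: two distinguished lines are exchanged exactly if `f x y = 1`. -/
def ComputableBit {X Y : Type} (Λ : Type) (r : ℕ) (f : X → Y → Fin 2) : Prop :=
  ∃ ι : Fin 2 → Λ, Function.Injective ι ∧ ∃ π : X → Y → Equiv.Perm Λ, AlternatingPerm r π ∧
    ∀ x y b, π x y (ι b) = ι (b + f x y)

namespace ComputableBit

variable {X Y X' Y' Λ : Type} {r r' : ℕ} {f g : X → Y → Fin 2}

/-- Conjugation by a constant permutation moves the distinguished lines, and Alice can do it for
free. Two bits can thus be computed on the same pair of lines. -/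
theorem exists_of_injective (h : ComputableBit Λ r f) {κ : Fin 2 → Λ}
    (hκ : Function.Injective κ) : ∃ π : X → Y → Equiv.Perm Λ, AlternatingPerm r π ∧
      ∀ x y b, π x y (κ b) = κ (b + f x y) := by
  obtain ⟨ι, hι, π, hπ, h⟩ := h
  obtain ⟨σ, hσ⟩ := exists_perm_comp_eq hι hκ
  refine ⟨fun x y => σ * π x y * σ⁻¹, ?_, fun x y b => ?_⟩
  · simpa using ((AlternatingPerm.alice fun _ => σ).mul hπ).mul (AlternatingPerm.alice fun _ => σ⁻¹)
  · have : σ⁻¹ (κ b) = ι b := by rw [← hσ]; simp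
    rw [Equiv.Perm.mul_apply, Equiv.Perm.mul_apply, this, h, hσ]

theorem comp (h : ComputableBit Λ r f) (px : X' → X) (py : Y' → Y) :
    ComputableBit Λ r (fun x y => f (px x) (py y)) := by
  obtain ⟨ι, hι, π, hπ, h⟩ := h
  exact ⟨ι, hι, _, hπ.comp px py, fun x y b => h _ _ b⟩

theorem mono (h : ComputableBit Λ r f) (hr : r ≤ r') : ComputableBit Λ r' f := by
  obtain ⟨ι, hι, π, hπ, h⟩ := h
  exact ⟨ι, hι, _, hπ.mono hr, h⟩

/-- On a common pair of lines, exchanging according to f and then according to g exchanges according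
to f + g. -/
theorem add (hf : ComputableBit Λ r f) (hg : ComputableBit Λ r' g) :
    ComputableBit Λ (r + r') (fun x y => f x y + g x y) := by
  obtain ⟨ι, hι, π, hπ, hf⟩ := hf
  obtain ⟨π', hπ', hg⟩ := hg.exists_of_injective hι
  exact ⟨ι, hι, _, hπ.mul hπ', fun x y b => by
    simp only [Equiv.Perm.mul_apply, hf, hg]; congr 1; abel⟩

theorem zero {ι : Fin 2 → Λ} (hι : Function.Injective ι) :
    ComputableBit Λ 0 (fun (_ : X) (_ : Y) => 0) :=
  ⟨ι, hι, fun _ _ => 1, .alice fun _ => 1, by simp⟩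

theorem sum {I : Type} (s : Finset I) {F : I → X → Y → Fin 2} {ι : Fin 2 → Λ}
    (hι : Function.Injective ι) (hF : ∀ i, ComputableBit Λ r (F i)) :
    ComputableBit Λ (s.card * r) (fun x y => ∑ i ∈ s, F i x y) := by
  classical
  induction s using Finset.induction_on with
  | empty => simpa using zero hι
  | insert i s hi ih =>
    simp only [Finset.sum_insert hi, Finset.card_insert_of_notMem hi]
    exact ((hF i).add ih).mono (by rw [Nat.succ_mul]; omega)

/-- An additive endomorphism of `Fin 2` is zero or the identity. -/
theorem addMonoidHom_comp (hf : ComputableBit Λ r f) (φ : Fin 2 →+ Fin 2) :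
    ComputableBit Λ r (fun x y => φ (f x y)) := by
  have key : ∀ b, φ b = if φ 1 = 0 then 0 else b := by
    intro b
    fin_cases b
    · simp
    · simp only [Fin.mk_one]
      split_ifs with h
      · exact h
      · omega
  by_cases h : φ 1 = 0
  · obtain ⟨ι, hι, -⟩ := hf
    have e : (fun x y => φ (f x y)) = fun _ _ => 0 := by
      funext x y; rw [key, if_pos h]
    rw [e]
    exact (zero hι).mono (Nat.zero_le r)
  · have e : (fun x y => φ (f x y)) = f := by
      funext x y; rw [key, if_neg h]
    rwa [e]

/-- The label stays idle. Bits known before a T gate can then be added to bits computed on the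
enlarged set of lines. -/
theorem lift {G : Type} [AddCommGroup G] (h : ComputableBit Λ r f) :
    ComputableBit (Λ × G) r f := by
  obtain ⟨ι, hι, π, hπ, h⟩ := h
  refine ⟨fun b => (ι b, 0), fun a b hab => hι (congrArg Prod.fst hab), _,
    hπ.map (liftPerm Λ G), fun x y b => ?_⟩
  simp [liftPerm, h]

/-- Every function of Bob's data is computed in one round on two lines. -/
theorem of_bob (g : Y → Fin 2) : ComputableBit (Fin 2) 1 (fun (_ : X) y => g y) :=
  ⟨id, Function.injective_id, fun _ y => Equiv.addRight (g y), .bob fun y => Equiv.addRight (g y),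
    fun _ _ _ => rfl⟩

end ComputableBit

/-! ### Schemes: local measurements on a shared maximally entangled state -/

/-- Alice and Bob share the (unnormalised) state `∑ e, |e⟩|e⟩`. Alice measures her input and her
share with Kraus operators `K x` and keeps a register `R`; Bob measures his input and his share
completely, with Kraus operators `L y`. -/
structure Scheme (A B R : Type) [Fintype A] [Fintype B] [Fintype R]
    [DecidableEq A] [DecidableEq B] where
  X : Type
  Y : Type
  E : Type
  [fintypeX : Fintype X]
  [fintypeY : Fintype Y]
  [fintypeE : Fintype E]
  [decidableEqE : DecidableEq E]
  K : X → Matrix R (A × E) ℂ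
  L : Y → B × E → ℂ
  complete_K : ∑ x, (K x)ᴴ * K x = 1
  complete_L : ∀ p q, ∑ y, star (L y p) * L y q = if p = q then 1 else 0

attribute [instance] Scheme.fintypeX Scheme.fintypeY Scheme.fintypeE Scheme.decidableEqE

theorem sum_conjTranspose_mul_eq_one_iff {ι R D : Type} [Fintype ι] [Fintype R] [DecidableEq D]
    {K : ι → Matrix R D ℂ} : ∑ i, (K i)ᴴ * K i = 1 ↔
      ∀ p q, ∑ i, ∑ r, star (K i r p) * K i r q = if p = q then 1 else 0 := by
  simp [← Matrix.ext_iff, Matrix.sum_apply, Matrix.mul_apply, Matrix.one_apply]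

/-! ### Extending a scheme by operations of Alice and by teleportation to Bob and back -/

namespace Scheme

variable {A B R R' : Type} [Fintype A] [Fintype B] [Fintype R] [Fintype R']
  [DecidableEq A] [DecidableEq B]

/-- The operator applied to the input when the outcomes are `x` and `y`, up to normalisation. -/
def amp (S : Scheme A B R) (x : S.X) (y : S.Y) : Matrix R (A × B) ℂ :=
  Matrix.of fun r p => ∑ e, S.K x r (p.1, e) * S.L y (p.2, e)

/-- Alice measures her register. -/
def measure [DecidableEq R] (S : Scheme A B R) {Z : Type} [Fintype Z]
    (M : S.X → Z → Matrix R' R ℂ) (hM : ∀ x, ∑ z, (M x z)ᴴ * M x z = 1) : Scheme A B R' where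
  X := S.X × Z
  Y := S.Y
  E := S.E
  K p := M p.1 p.2 * S.K p.1
  L := S.L
  complete_K := by
    simp only [Fintype.sum_prod_type, Matrix.conjTranspose_mul]
    rw [← S.complete_K]
    refine Finset.sum_congr rfl fun x _ => ?_
    have : ∀ z, (S.K x)ᴴ * (M x z)ᴴ * (M x z * S.K x) =
        (S.K x)ᴴ * ((M x z)ᴴ * M x z) * S.K x := fun z => by simp only [Matrix.mul_assoc]
    simp only [this]
    rw [← Matrix.sum_mul, ← Matrix.mul_sum, hM, Matrix.mul_one]
  complete_L := S.complete_L

theorem measure_amp [DecidableEq R] (S : Scheme A B R) {Z : Type} [Fintype Z]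
    (M : S.X → Z → Matrix R' R ℂ) (hM : ∀ x, ∑ z, (M x z)ᴴ * M x z = 1) (x : S.X) (z : Z)
    (y : S.Y) : (S.measure M hM).amp (x, z) y = M x z * S.amp x y := by
  ext r p
  simp only [amp, measure, Matrix.of_apply, Matrix.mul_apply, Finset.sum_mul, Finset.mul_sum]
  rw [Finset.sum_comm]
  simp only [mul_assoc]
  rfl

/-- Alice applies an isometry to her register. -/
def isometry [DecidableEq R] (S : Scheme A B R) (M : S.X → Matrix R' R ℂ)
    (hM : ∀ x, (M x)ᴴ * M x = 1) : Scheme A B R' where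
  X := S.X
  Y := S.Y
  E := S.E
  K x := M x * S.K x
  L := S.L
  complete_K := by
    rw [← S.complete_K]
    refine Finset.sum_congr rfl fun x _ => ?_
    rw [Matrix.conjTranspose_mul, Matrix.mul_assoc, ← Matrix.mul_assoc (M x)ᴴ, hM, Matrix.one_mul]
  complete_L := S.complete_L

theorem isometry_amp [DecidableEq R] (S : Scheme A B R) (M : S.X → Matrix R' R ℂ)
    (hM : ∀ x, (M x)ᴴ * M x = 1) (x : S.X) (y : S.Y) :
    (S.isometry M hM).amp x y = M x * S.amp x y := by
  ext r p
  simp only [amp, isometry, Matrix.of_apply, Matrix.mul_apply, Finset.sum_mul, Finset.mul_sum]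
  rw [Finset.sum_comm]
  simp only [mul_assoc]
  rfl

/-- Later constructions use only this interface: how new outcomes determine old ones, the size of
the shared register, and the operator applied to the input. -/
theorem exists_isometry [DecidableEq R] (S : Scheme A B R) (M : S.X → Matrix R' R ℂ)
    (hM : ∀ x, (M x)ᴴ * M x = 1) :
    ∃ (S' : Scheme A B R') (qx : S'.X → S.X) (qy : S'.Y → S.Y),
      Fintype.card S'.E = Fintype.card S.E ∧
      ∀ x y, S'.amp x y = M (qx x) * S.amp (qx x) (qy y) :=
  ⟨S.isometry M hM, fun x => x, fun y => y, rfl, S.isometry_amp M hM⟩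

theorem exists_measure [DecidableEq R] (S : Scheme A B R) {Z : Type} [Fintype Z]
    (M : S.X → Z → Matrix R' R ℂ) (hM : ∀ x, ∑ z, (M x z)ᴴ * M x z = 1) :
    ∃ (S' : Scheme A B R') (qx : S'.X → S.X) (qy : S'.Y → S.Y) (z : S'.X → Z),
      Fintype.card S'.E = Fintype.card S.E ∧
      ∀ x y, S'.amp x y = M (qx x) (z x) * S.amp (qx x) (qy y) :=
  ⟨S.measure M hM, Prod.fst, fun y => y, Prod.snd, rfl, fun x y => S.measure_amp M hM x.1 x.2 y⟩

/-- The completeness relation of a teleportation measurement: the matrices `W u` form an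
orthogonal operator basis, normalised like unitaries. -/
def IsOperatorBasis {U D : Type} [Fintype U] [Fintype D] [DecidableEq D]
    (W : U → Matrix D D ℂ) : Prop :=
  ∀ i j i' j', ∑ u, star (W u i j) * W u i' j' =
    if i = i' ∧ j = j' then (Fintype.card D : ℂ) else 0

theorem isOperatorBasis_lineMap_pauli {Λ : Type} [Fintype Λ] [DecidableEq Λ]
    (π : Equiv.Perm Λ) :
    IsOperatorBasis fun u : Λ → Fin 2 × Fin 2 => lineMap π (fun l => pauli (u l)) :=
  sum_star_lineMap_pauli_mul π

/-- The normalisation factor of a teleportation measurement. -/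
noncomputable def teleportScalar (D : Type) [Fintype D] : ℂ :=
  (((Real.sqrt (Fintype.card D) : ℝ) : ℂ))⁻¹

theorem star_teleportScalar_mul (D : Type) [Fintype D] [Nonempty D] :
    star (teleportScalar D) * teleportScalar D * (Fintype.card D : ℂ) = 1 := by
  have h : ((Real.sqrt (Fintype.card D) : ℝ) : ℂ) * ((Real.sqrt (Fintype.card D) : ℝ) : ℂ) =
      (Fintype.card D : ℂ) := by
    rw [← Complex.ofReal_mul, Real.mul_self_sqrt (Nat.cast_nonneg _)]; simp
  have h0 : (Fintype.card D : ℂ) ≠ 0 := Nat.cast_ne_zero.2 Fintype.card_ne_zero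
  have h1 : star (teleportScalar D) = teleportScalar D := by
    simp [teleportScalar, Complex.conj_ofReal]
  rw [h1, teleportScalar, ← mul_inv, h, inv_mul_cancel₀ h0]

theorem star_teleportScalar_mul' (D : Type) [Fintype D] [Nonempty D] :
    star (teleportScalar D) * (teleportScalar D * (Fintype.card D : ℂ)) = 1 := by
  rw [← mul_assoc, star_teleportScalar_mul]

/-- Alice teleports the part `D` of her register to Bob, who applies an operation and teleports
it back, with noise from the operator bases `W` and `W'`. -/
noncomputable def roundTrip {D R₀ U V : Type} [Fintype D] [DecidableEq D] [Nonempty D]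
    [Fintype R₀] [Fintype U] [Fintype V]
    (S : Scheme A B (D × R₀)) (W : U → Matrix D D ℂ) (hW : IsOperatorBasis W)
    (W' : S.Y → V → Matrix D D ℂ) (hW' : ∀ y, IsOperatorBasis (W' y)) :
    Scheme A B (D × R₀) where
  X := S.X × U
  Y := S.Y × V
  E := S.E × D × D
  -- The first new share is measured jointly with the register `D`; the second is where Alice
  -- receives `D` back, so it becomes her new register.
  K p := Matrix.of fun r q => if r.1 = q.2.2.2 then
    teleportScalar D * ∑ s, W p.2 q.2.2.1 s * S.K p.1 (s, r.2) (q.1, q.2.1) else 0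
  -- Bob joins the arriving and the returning share. His operation on `D` is part of the basis `W'`,
  -- which may depend on his earlier outcome.
  L p q := S.L p.1 (q.1, q.2.1) * (teleportScalar D * W' p.1 p.2 q.2.2.2 q.2.2.1)
  complete_K := by
    rw [sum_conjTranspose_mul_eq_one_iff]
    rintro ⟨a, e, i, j⟩ ⟨a', e', i', j'⟩
    have hK := sum_conjTranspose_mul_eq_one_iff.1 S.complete_K (a, e) (a', e')
    simp only [Fintype.sum_prod_type, Matrix.of_apply, apply_ite star, star_zero, ite_mul,
      zero_mul, mul_ite, mul_zero] at hK ⊢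
    simp only [Finset.sum_ite_irrel, Finset.sum_const_zero, Finset.sum_ite_eq',
      Finset.mem_univ, if_true]
    by_cases hj : j = j'
    swap
    · simp [hj, Ne.symm hj]
    subst hj
    simp only [if_true]
    have step : ∀ x, ∑ u, ∑ r₀, star (teleportScalar D * ∑ s, W u i s * S.K x (s, r₀) (a, e)) *
        (teleportScalar D * ∑ s, W u i' s * S.K x (s, r₀) (a', e')) =
        if i = i' then ∑ s, ∑ r₀, star (S.K x (s, r₀) (a, e)) * S.K x (s, r₀) (a', e') else 0 := by
      intro x
      have h1 : ∀ u r₀, star (teleportScalar D * ∑ s, W u i s * S.K x (s, r₀) (a, e)) *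
        (teleportScalar D * ∑ s, W u i' s * S.K x (s, r₀) (a', e')) =
        ∑ s, ∑ s', (star (teleportScalar D) * teleportScalar D *
          (star (S.K x (s, r₀) (a, e)) * S.K x (s', r₀) (a', e'))) *
          (star (W u i s) * W u i' s') := by
        intro u r₀
        rw [star_mul', star_sum, mul_mul_mul_comm, Finset.sum_mul_sum, Finset.mul_sum]
        refine Finset.sum_congr rfl fun s _ => ?_
        rw [Finset.mul_sum]
        refine Finset.sum_congr rfl fun s' _ => ?_
        rw [star_mul']
        ring
      simp only [h1]
      rw [Finset.sum_comm]
      have h2 : ∀ r₀, ∑ u, ∑ s, ∑ s', (star (teleportScalar D) * teleportScalar D *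
          (star (S.K x (s, r₀) (a, e)) * S.K x (s', r₀) (a', e'))) *
          (star (W u i s) * W u i' s') = if i = i' then
            ∑ s, star (S.K x (s, r₀) (a, e)) * S.K x (s, r₀) (a', e') else 0 := by
        intro r₀
        rw [Finset.sum_comm]
        have h3 : ∀ s, ∑ u, ∑ s', (star (teleportScalar D) * teleportScalar D *
          (star (S.K x (s, r₀) (a, e)) * S.K x (s', r₀) (a', e'))) *
          (star (W u i s) * W u i' s') = if i = i' then
            star (S.K x (s, r₀) (a, e)) * S.K x (s, r₀) (a', e') else 0 := by
          intro s
          rw [Finset.sum_comm]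
          simp only [← Finset.mul_sum, hW i s i' _]
          by_cases hi : i = i'
          · simp only [hi, true_and, mul_ite, mul_zero, Finset.sum_ite_eq, Finset.mem_univ,
              if_true]
            rw [mul_right_comm, star_teleportScalar_mul, one_mul]
          · simp [hi]
        simp only [h3]
        split_ifs <;> simp
      simp only [h2]
      split_ifs
      · rw [Finset.sum_comm]
      · simp
    simp only [step]
    by_cases hi : i = i'
    · subst hi
      simp only [if_true, hK, Prod.mk.injEq, and_true]
    · simp [hi]
  complete_L := by
    rintro ⟨b, e, i, j⟩ ⟨b', e', i', j'⟩
    have hL := S.complete_L (b, e) (b', e')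
    simp only [Fintype.sum_prod_type]
    have h1 : ∀ y v, star (S.L y (b, e) * (teleportScalar D * W' y v j i)) *
        (S.L y (b', e') * (teleportScalar D * W' y v j' i')) =
        (star (S.L y (b, e)) * S.L y (b', e') *
          (star (teleportScalar D) * teleportScalar D)) *
          (star (W' y v j i) * W' y v j' i') := by
      intro y v
      simp only [star_mul']
      ring
    simp only [h1, ← Finset.mul_sum, hW' _ j i j' i']
    by_cases hj : j = j' ∧ i = i'
    · obtain ⟨rfl, rfl⟩ := hj
      simp only [and_self, if_true, mul_assoc]
      rw [star_teleportScalar_mul' D]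
      simp only [mul_one, hL, Prod.mk.injEq, and_true]
    · have : ¬ ((b, e, i, j) = (b', e', i', j')) := by
        simp only [Prod.mk.injEq]; tauto
      simp [hj, this]

/-- Contracting the two shared registers composes the matrices of the two measurements, with one
normalising scalar for each teleportation. No outcome is postselected and no error is corrected. -/
theorem roundTrip_amp {D R₀ U V : Type} [Fintype D] [DecidableEq D] [Nonempty D]
    [Fintype R₀] [DecidableEq R₀] [Fintype U] [Fintype V]
    (S : Scheme A B (D × R₀)) (W : U → Matrix D D ℂ) (hW : IsOperatorBasis W)
    (W' : S.Y → V → Matrix D D ℂ) (hW' : ∀ y, IsOperatorBasis (W' y)) (x : S.X) (u : U)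
    (y : S.Y) (v : V) :
    (S.roundTrip W hW W' hW').amp (x, u) (y, v) =
      (teleportScalar D * teleportScalar D) •
        (((W' y v * W u) ⊗ₖ (1 : Matrix R₀ R₀ ℂ)) * S.amp x y) := by
  ext ⟨s, r₀⟩ ⟨a, b⟩
  have hr : (((W' y v * W u) ⊗ₖ (1 : Matrix R₀ R₀ ℂ)) * S.amp x y) (s, r₀) (a, b) =
      ∑ t, (W' y v * W u) s t * S.amp x y (t, r₀) (a, b) := by
    simp [Matrix.mul_apply, Fintype.sum_prod_type, Matrix.kroneckerMap_apply, Matrix.one_apply,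
      mul_ite, ite_mul]
  rw [Matrix.smul_apply, hr]
  simp only [amp, Matrix.of_apply, Matrix.mul_apply, smul_eq_mul]
  change ∑ q : S.E × D × D, _ = _
  simp only [roundTrip, Matrix.of_apply, Fintype.sum_prod_type, ite_mul, zero_mul,
    Finset.sum_ite_eq, Finset.mem_univ, if_true, Finset.mul_sum, Finset.sum_mul]
  rw [Finset.sum_comm]
  have h1 : ∀ i : D, ∑ e, ∑ t, teleportScalar D * (W u i t * S.K x (t, r₀) (a, e)) *
        (S.L y (b, e) * (teleportScalar D * W' y v s i)) =
      ∑ t, ∑ e, teleportScalar D * teleportScalar D *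
        (W' y v s i * W u i t * (S.K x (t, r₀) (a, e) * S.L y (b, e))) := by
    intro i
    rw [Finset.sum_comm]
    exact Finset.sum_congr rfl fun t _ => Finset.sum_congr rfl fun e _ => by ring
  simp only [h1]
  rw [Finset.sum_comm]
  refine Finset.sum_congr rfl fun t _ => ?_
  rw [Finset.sum_comm]

theorem exists_roundTrip {D R₀ U V : Type} [Fintype D] [DecidableEq D] [Nonempty D]
    [Fintype R₀] [DecidableEq R₀] [Fintype U] [Fintype V]
    (S : Scheme A B (D × R₀)) (W : U → Matrix D D ℂ) (hW : IsOperatorBasis W)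
    (W' : S.Y → V → Matrix D D ℂ) (hW' : ∀ y, IsOperatorBasis (W' y)) :
    ∃ (S' : Scheme A B (D × R₀)) (qx : S'.X → S.X) (u : S'.X → U) (qy : S'.Y → S.Y)
      (v : S'.Y → V), Fintype.card S'.E = Fintype.card S.E * Fintype.card D ^ 2 ∧
      ∀ x y, S'.amp x y = (teleportScalar D * teleportScalar D) •
        (((W' (qy y) (v y) * W (u x)) ⊗ₖ (1 : Matrix R₀ R₀ ℂ)) * S.amp (qx x) (qy y)) := by
  refine ⟨S.roundTrip W hW W' hW', Prod.fst, Prod.snd, Prod.fst, Prod.snd, ?_,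
    fun x y => S.roundTrip_amp W hW W' hW' x.1 x.2 y.1 y.2⟩
  change Fintype.card (S.E × D × D) = _
  rw [Fintype.card_prod, Fintype.card_prod, sq]

/-- Running an alternating permutation on teleported lines: each line moves as prescribed and
picks up a Pauli error `M`, and the errors themselves can be tracked in the same number of
rounds. -/
theorem exists_run {X Y Λ R₀ : Type} [Fintype Λ] [DecidableEq Λ] [Fintype R₀] [DecidableEq R₀]
    {r : ℕ} {π : X → Y → Equiv.Perm Λ} (h : AlternatingPerm r π) :
    ∀ (S : Scheme A B (Qubits Λ × R₀)) (px : S.X → X) (py : S.Y → Y),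
      ∃ (S' : Scheme A B (Qubits Λ × R₀)) (qx : S'.X → S.X) (qy : S'.Y → S.Y)
        (M : S'.X → S'.Y → Λ → Fin 2 × Fin 2),
        Fintype.card S'.E = Fintype.card S.E * 2 ^ (2 * Fintype.card Λ * r) ∧
        (∀ x y, ∃ c : ℂ, S'.amp x y =
          c • ((lineMap (π (px (qx x)) (py (qy y))) (fun l => pauli (M x y l)) ⊗ₖ
            (1 : Matrix R₀ R₀ ℂ)) * S.amp (qx x) (qy y))) ∧
        ∀ θ : Fin 2 × Fin 2 →+ Fin 2 × Fin 2, AlternatingPerm r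
          (fun x y => twist (π (px (qx x)) (py (qy y))) (fun l => θ (M x y l))) := by
  induction h with
  | alice σ =>
    intro S px py
    obtain ⟨S', qx, qy, hcard, hamp⟩ := S.exists_isometry
      (fun x => lineMap (σ (px x)) (fun _ => pauli 0) ⊗ₖ (1 : Matrix R₀ R₀ ℂ)) (fun x => by
        rw [Matrix.conjTranspose_kronecker, ← Matrix.mul_kronecker_mul,
          lineMap_conjTranspose_mul _ _ fun _ => pauli_conjTranspose_mul _]
        simp)
    exact ⟨S', qx, qy, fun _ _ _ => 0, by simpa using hcard,
      fun x y => ⟨1, by rw [one_smul]; exact hamp x y⟩,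
      fun θ => .alice fun x => twist (σ (px (qx x))) (fun _ => θ 0)⟩
  | bob τ =>
    intro S px py
    obtain ⟨S', qx, u, qy, v, hcard, hamp⟩ := S.exists_roundTrip
      (fun u : Λ → Fin 2 × Fin 2 => lineMap 1 (fun l => pauli (u l)))
      (isOperatorBasis_lineMap_pauli 1)
      (fun y (v : Λ → Fin 2 × Fin 2) => lineMap (τ (py y)) (fun l => pauli (v l)))
      (fun y => isOperatorBasis_lineMap_pauli (τ (py y)))
    refine ⟨S', qx, qy, fun x y l => v y l + u x l, ?_, fun x y => ?_, fun θ => ?_⟩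
    · rw [hcard]
      simp only [Fintype.card_pi, Fintype.card_fin, Finset.prod_const, Finset.card_univ]
      ring
    · obtain ⟨c, hc⟩ := lineMap_pauli_mul (τ (py (qy y))) 1 (v y) (u x)
      refine ⟨teleportScalar (Qubits Λ) * teleportScalar (Qubits Λ) * c, ?_⟩
      rw [hamp, hc, mul_one, Matrix.smul_kronecker, Matrix.smul_mul, smul_smul]
      rfl
    -- Alice's outcome is an error on lines that have not moved, a twist of hers alone; Bob's
    -- outcome is tracked together with his permutation. The product still has one round of Bob.
    · have := (AlternatingPerm.bob (X := S'.X)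
        fun y : S'.Y => twist (τ (py (qy y))) (fun l => θ (v y l))).mul
        (.alice fun x : S'.X => twist 1 (fun l => θ (u x l)))
      simpa only [twist_mul, mul_one, map_add, Equiv.Perm.one_apply] using this
  | @mul r r' π π' h h' ih ih' =>
    intro S px py
    -- The right factor acts first; the error of the second run is read at the position reached
    -- after the first.
    obtain ⟨S₁, qx, qy, M₁, hcard₁, hamp₁, hθ₁⟩ := ih' S px py
    obtain ⟨S₂, rx, ry, M₂, hcard₂, hamp₂, hθ₂⟩ := ih S₁ (px ∘ qx) (py ∘ qy)
    refine ⟨S₂, qx ∘ rx, qy ∘ ry, fun x y l =>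
      M₂ x y (π' (px (qx (rx x))) (py (qy (ry y))) l) + M₁ (rx x) (ry y) l, ?_, ?_, fun θ => ?_⟩
    · rw [hcard₂, hcard₁]
      ring
    · intro x y
      obtain ⟨c₁, hc₁⟩ := hamp₁ (rx x) (ry y)
      obtain ⟨c₂, hc₂⟩ := hamp₂ x y
      obtain ⟨c, hc⟩ := lineMap_pauli_mul (π (px (qx (rx x))) (py (qy (ry y))))
        (π' (px (qx (rx x))) (py (qy (ry y)))) (M₂ x y) (M₁ (rx x) (ry y))
      refine ⟨c₂ * c₁ * c, ?_⟩
      rw [hc₂, hc₁, Matrix.mul_smul, ← Matrix.mul_assoc, ← Matrix.mul_kronecker_mul]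
      simp only [Function.comp_apply]
      rw [hc, mul_one, Matrix.smul_kronecker, Matrix.smul_mul, smul_smul, smul_smul]
    · have := (hθ₂ θ).mul ((hθ₁ θ).comp rx ry)
      simpa only [twist_mul, map_add, Function.comp_apply] using this

end Scheme

/-! ### Correcting a phase gate that is controlled by a bit shared between Alice and Bob -/

/-- The isometry that maps the basis state `r` to the basis state `g r`. -/
def basisMap {R R' : Type} [DecidableEq R'] (g : R → R') : Matrix R' R ℂ :=
  Matrix.of fun p r => if p = g r then 1 else 0

theorem basisMap_conjTranspose_mul {R R' : Type} [Fintype R'] [DecidableEq R] [DecidableEq R']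
    {g : R → R'} (hg : Function.Injective g) : (basisMap g)ᴴ * basisMap g = 1 := by
  ext r s
  simp [basisMap, Matrix.mul_apply, Matrix.one_apply, hg.eq_iff, apply_ite, eq_comm]

/-- Measuring part of the image of an isometry is a complete measurement. -/
theorem sum_basisMap_submatrix {R R' Z : Type} [Fintype R'] [Fintype Z] [DecidableEq R]
    [DecidableEq R'] [DecidableEq Z] {g : R → Z × R'} (hg : Function.Injective g) :
    ∑ z, ((basisMap g).submatrix (Prod.mk z) id)ᴴ * (basisMap g).submatrix (Prod.mk z) id = 1 := by
  rw [← basisMap_conjTranspose_mul hg]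
  ext r s
  simp [Matrix.sum_apply, Matrix.mul_apply, Fintype.sum_prod_type]

/-! ### Routing the qubit of one wire through a set of lines -/

section wire

variable {Λ W : Type} [DecidableEq Λ] [DecidableEq W]

/-- Move the qubit on wire `w` to line `l₀`, with `|0⟩` on wire `w` and all other lines. -/
def wireToLine (w : W) (l₀ : Λ) (r : Qubits W) : Qubits Λ × Qubits W :=
  (Function.update 0 l₀ (r w), Function.update r w 0)

/-- Move the qubit on line `l₀` to wire `w`, and measure all other lines and wire `w`. -/
def lineToWire (w : W) (l₀ : Λ) (p : Qubits Λ × Qubits W) : (Qubits Λ × Fin 2) × Qubits W :=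
  ((Function.update p.1 l₀ 0, p.2 w), Function.update p.2 w (p.1 l₀))

theorem wireToLine_injective (w : W) (l₀ : Λ) : Function.Injective (wireToLine w l₀) := by
  intro r s h
  simp only [wireToLine, Prod.mk.injEq] at h
  funext v
  by_cases hv : v = w
  · subst hv
    simpa using congrFun h.1 l₀
  · simpa [hv] using congrFun h.2 v

theorem lineToWire_injective (w : W) (l₀ : Λ) : Function.Injective (lineToWire w l₀) := by
  rintro ⟨s, r⟩ ⟨s', r'⟩ h
  simp only [lineToWire, Prod.mk.injEq] at h
  obtain ⟨⟨h1, h2⟩, h3⟩ := h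
  refine Prod.ext (funext fun l => ?_) (funext fun v => ?_)
  · by_cases hl : l = l₀
    · subst hl
      simpa using congrFun h3 w
    · simpa [hl] using congrFun h1 l
  · by_cases hv : v = w
    · subst hv
      exact h2
    · simpa [hv] using congrFun h3 v

/-- The qubit returns to its line carrying only the operator met there. The other lines start in a
basis state, never interact with it and are measured, so they contribute a scalar. -/
theorem lineToWire_mul_lineMap_mul_wireToLine [Fintype Λ] [Fintype W] (w : W) (l₀ : Λ)
    (z : Qubits Λ × Fin 2)
    (π : Equiv.Perm Λ) (hπ : π l₀ = l₀) (M : Λ → Matrix (Fin 2) (Fin 2) ℂ) :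
    ∃ c : ℂ, (basisMap (lineToWire w l₀)).submatrix (Prod.mk z) id *
      ((lineMap π M ⊗ₖ (1 : Matrix (Qubits W) (Qubits W) ℂ)) * basisMap (wireToLine w l₀)) =
      c • onWire w (M l₀) := by
  -- The line `l₀` is emptied before the measurement and wire `w` holds 0, so other values there are
  -- impossible outcomes. Each remaining line contributes the entry from its initial 0 to the value
  -- found.
  refine ⟨if z.1 l₀ = 0 ∧ z.2 = 0 then ∏ l ∈ Finset.univ.erase l₀, M l (z.1 (π l)) 0 else 0, ?_⟩
  ext r' r
  have h1 : ∀ q, ((lineMap π M ⊗ₖ (1 : Matrix (Qubits W) (Qubits W) ℂ)) *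
      basisMap (wireToLine w l₀)) q r = lineMap π M q.1 (Function.update 0 l₀ (r w)) *
      if q.2 = Function.update r w 0 then 1 else 0 := by
    intro q
    rw [Matrix.mul_apply]
    simp only [basisMap, Matrix.of_apply, mul_ite, mul_one, mul_zero, Finset.sum_ite_eq',
      Finset.mem_univ, if_true]
    simp [wireToLine, Matrix.kroneckerMap_apply, Matrix.one_apply]
  rw [Matrix.mul_apply]
  simp only [h1]
  simp only [Fintype.sum_prod_type, Matrix.submatrix_apply, id_eq, basisMap, Matrix.of_apply,
    mul_ite, mul_one, mul_zero, Finset.sum_ite_eq', Finset.mem_univ, if_true, ite_mul, one_mul,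
    zero_mul, Matrix.smul_apply, smul_eq_mul, onWire]
  have hiff : ∀ s, (z, r') = lineToWire w l₀ (s, Function.update r w 0) ↔
      (z.1 l₀ = 0 ∧ z.2 = 0) ∧ (∀ v, v ≠ w → r' v = r v) ∧ s = Function.update z.1 l₀ (r' w) := by
    intro s
    obtain ⟨z₁, z₂⟩ := z
    simp only [lineToWire, Prod.mk.injEq, Function.update_self, Function.update_idem]
    constructor
    · rintro ⟨⟨rfl, rfl⟩, rfl⟩
      refine ⟨by simp, fun v hv => by simp [hv], ?_⟩
      simp
    · rintro ⟨⟨h1, rfl⟩, h2, rfl⟩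
      refine ⟨⟨?_, rfl⟩, ?_⟩
      · rw [Function.update_idem, ← h1, Function.update_eq_self]
      · funext v
        by_cases hv : v = w
        · subst hv; simp
        · simp [hv, h2 v hv]
  simp only [hiff]
  by_cases hz : z.1 l₀ = 0 ∧ z.2 = 0
  swap
  · simp [hz]
  by_cases hr : ∀ v, v ≠ w → r' v = r v
  swap
  · simp [hr]
  simp only [hz, eq_true hr, true_and, Finset.sum_ite_eq', Finset.mem_univ, if_true, lineMap,
    Matrix.of_apply, and_self]
  rw [← Finset.mul_prod_erase _ _ (Finset.mem_univ l₀), hπ, mul_comm]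
  simp only [Function.update_self]
  refine congrArg (· * _) (Finset.prod_congr rfl fun l hl => ?_)
  have hl : l ≠ l₀ := (Finset.mem_erase.1 hl).1
  have hl' : π l ≠ l₀ := fun h => hl (π.injective (h.trans hπ.symm))
  simp [hl, hl']

end wire

/-- The inverse of the phase gate, applied if `b = 1`. -/
def phaseInv (b : Fin 2) : Matrix (Fin 2) (Fin 2) ℂ := if b = 1 then !![1, 0; 0, -Complex.I] else 1

theorem phaseInv_conjTranspose_mul (b : Fin 2) : (phaseInv b)ᴴ * phaseInv b = 1 := by
  fin_cases b <;> ext i j <;> fin_cases i <;> fin_cases j <;>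
    simp [phaseInv, Matrix.mul_apply]

/-- P⁻¹X equals XZP⁻¹ up to phase, while P⁻¹ commutes with Z. The resulting product of the two bits
is the only nonlinear term in the evolution of the key. -/
theorem phaseInv_mul_pauli (b : Fin 2) (p : Fin 2 × Fin 2) :
    ∃ c : ℂ, phaseInv b * pauli p = c • (pauli (p + (0, b * p.1)) * phaseInv b) := by
  obtain ⟨a, d⟩ := p
  refine ⟨if b = 1 ∧ a = 1 then -Complex.I else 1, ?_⟩
  ext i j
  fin_cases a <;> fin_cases b <;> fin_cases d <;> fin_cases i <;> fin_cases j <;>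
    simp [phaseInv, pauli, bitSign, Matrix.mul_apply]

theorem pauli_mul_phaseInv_mul_pauli (b : Fin 2) (p q : Fin 2 × Fin 2) :
    ∃ c : ℂ, pauli q * (phaseInv b * pauli p) =
      c • (pauli (q + (p + (0, b * p.1))) * phaseInv b) := by
  obtain ⟨c, hc⟩ := phaseInv_mul_pauli b p
  refine ⟨c * bitSign (q.2 * (p + (0, b * p.1)).1), ?_⟩
  rw [hc, Matrix.mul_smul, ← Matrix.mul_assoc, pauli_mul, Matrix.smul_mul, smul_smul]

theorem onWire_smul {W : Type} [Fintype W] [DecidableEq W] (w : W) (c : ℂ)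
    (M : Matrix (Fin 2) (Fin 2) ℂ) : onWire w (c • M) = c • onWire w M := by
  ext x y
  simp [onWire]

/-- The permutation adding the first bit to the second one on a line `l₁`. -/
def shear {Λ : Type} [DecidableEq Λ] (l₁ : Λ) : Equiv.Perm (Λ × (Fin 2 × Fin 2)) where
  toFun p := (p.1, (p.2.1, p.2.2 + if p.1 = l₁ then p.2.1 else 0))
  invFun p := (p.1, (p.2.1, p.2.2 - if p.1 = l₁ then p.2.1 else 0))
  left_inv p := by simp
  right_inv p := by simp

/-- The X and Z parts of the total Pauli error picked up while a qubit is routed along the lines,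
corrected, and routed back. -/
theorem computableBit_error {X Y Λ : Type} [DecidableEq Λ] {r : ℕ} {f : X → Y → Fin 2}
    {ι : Fin 2 → Λ} (hι : Function.Injective ι) {π : X → Y → Equiv.Perm Λ}
    (hπ : ∀ x y b, π x y (ι b) = ι (b + f x y)) {M₁ M₂ : X → Y → Λ → Fin 2 × Fin 2}
    (h₁ : ∀ θ : Fin 2 × Fin 2 →+ Fin 2 × Fin 2, AlternatingPerm r
      (fun x y => twist (π x y) (fun l => θ (M₁ x y l))))
    (h₂ : ∀ θ : Fin 2 × Fin 2 →+ Fin 2 × Fin 2, AlternatingPerm r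
      (fun x y => twist (π x y)⁻¹ (fun l => θ (M₂ x y l)))) :
    ComputableBit (Λ × (Fin 2 × Fin 2)) (2 * r) (fun x y =>
      (M₂ x y (ι (f x y)) + (M₁ x y (ι 0) + (0, f x y * (M₁ x y (ι 0)).1))).1) ∧
    ComputableBit (Λ × (Fin 2 × Fin 2)) (4 * r) (fun x y =>
      (M₂ x y (ι (f x y)) + (M₁ x y (ι 0) + (0, f x y * (M₁ x y (ι 0)).1))).2) := by
  have hπ0 : ∀ x y, π x y (ι 0) = ι (f x y) := fun x y => by rw [hπ, zero_add]
  have hπ' : ∀ x y, (π x y)⁻¹ (ι (f x y)) = ι 0 := fun x y => by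
    rw [Equiv.Perm.inv_eq_iff_eq, hπ0]
  have hinv : ∀ (σ : Equiv.Perm Λ) (t : Λ → Fin 2 × Fin 2) (l : Λ) (g : Fin 2 × Fin 2),
    (twist σ t)⁻¹ (l, g) = (σ⁻¹ l, g - t (σ⁻¹ l)) := fun _ _ _ _ => rfl
  let θx : Fin 2 × Fin 2 →+ Fin 2 × Fin 2 := (AddMonoidHom.fst _ _).prod 0
  let θz : Fin 2 × Fin 2 →+ Fin 2 × Fin 2 := AddMonoidHom.prod 0 (AddMonoidHom.snd _ _)
  have hθx : ∀ p, θx p = (p.1, 0) := fun _ => rfl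
  have hθz : ∀ p, θz p = (0, p.2) := fun _ => rfl
  constructor
  -- Going out collects the X part of `M₁`, coming back that of `M₂`; the correction term has no X
  -- part.
  · refine ⟨fun b => (ι 0, (b, 0)), fun a b h => by simpa using h, _,
      by simpa [two_mul] using (h₂ θx).mul (h₁ θx), fun x y b => ?_⟩
    simp only [Equiv.Perm.mul_apply, twist_apply, hθx, hπ0, hπ', Prod.mk.injEq, true_and,
      Prod.mk_add_mk, Prod.fst_add, add_zero, and_true]
    abel
  · have hs : ∀ x y (g : Fin 2 × Fin 2), shear (ι 1) (ι (f x y), g) =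
        (ι (f x y), (g.1, g.2 + f x y * g.1)) := by
      intro x y g
      change (_, _, _) = _
      simp only [hι.eq_iff]
      rcases Fin.exists_fin_two.1 ⟨f x y, rfl⟩ with h | h <;> simp [h]
    -- Read the product from right to left. Going out collects all of `M₁`; the shear on `ι 1` adds
    -- f times the X label to the Z label; coming back subtracts the X part and clears the X label;
    -- going out again adds nothing; the last way back collects the Z part of `M₂`. These are four
    -- runs, and the shear is free.
    refine ⟨fun b => (ι 0, (0, b)), fun a b h => by simpa using h, _,
      (((((h₂ θz).mul (h₁ 0)).mul (h₁ θx).inv).mul (.alice fun _ => shear (ι 1))).mul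
        (h₁ (AddMonoidHom.id _))).mono (by omega), fun x y b => ?_⟩
    simp only [Equiv.Perm.mul_apply, twist_apply, hinv, hs, hθx, hθz, hπ0, hπ', Prod.mk.injEq,
      true_and, Prod.mk_add_mk, Prod.snd_add, Prod.fst_add, Prod.mk_sub_mk,
      AddMonoidHom.id_apply, AddMonoidHom.zero_apply, zero_add, add_zero, sub_self,
      sub_zero, true_and]
    abel

namespace Scheme

variable {A B W : Type} [Fintype A] [Fintype B] [DecidableEq A] [DecidableEq B] [Fintype W]
  [DecidableEq W]

/-- If the bit `f` is computable in `r` rounds on lines `Λ`, the inverse of the phase gate can be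
applied to wire `w` if `f = 1`, up to a Pauli error on that wire which is again computable. -/
theorem exists_phaseInv {Λ : Type} [Fintype Λ] (S : Scheme A B (Qubits W)) (w : W) {r : ℕ}
    {f : S.X → S.Y → Fin 2} (hf : ComputableBit Λ r f) :
    ∃ (S' : Scheme A B (Qubits W)) (qx : S'.X → S.X) (qy : S'.Y → S.Y)
      (δ : S'.X → S'.Y → Fin 2 × Fin 2),
      Fintype.card S'.E = Fintype.card S.E * 2 ^ (4 * Fintype.card Λ * r) ∧
      (∀ x y, ∃ c : ℂ, S'.amp x y =
        c • (onWire w (pauli (δ x y) * phaseInv (f (qx x) (qy y))) * S.amp (qx x) (qy y))) ∧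
      ComputableBit (Λ × (Fin 2 × Fin 2)) (2 * r) (fun x y => (δ x y).1) ∧
      ComputableBit (Λ × (Fin 2 × Fin 2)) (4 * r) (fun x y => (δ x y).2) := by
  classical
  obtain ⟨ι, hι, π, hπ, hπf⟩ := hf
  have hπ0 : ∀ x y, π x y (ι 0) = ι (f x y) := fun x y => by rw [hπf, zero_add]
  obtain ⟨S₁, ax, ay, hcard₁, hamp₁⟩ := S.exists_isometry
    (fun _ => basisMap (wireToLine w (ι 0)))
    (fun _ => basisMap_conjTranspose_mul (wireToLine_injective w (ι 0)))
  obtain ⟨S₂, bx, bY, M₁, hcard₂, hamp₂, hM₁⟩ := exists_run hπ S₁ ax ay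
  -- Alice does not know where the qubit is: the gate is always applied to `ι 1`, which holds the
  -- qubit exactly if f = 1.
  let D : Λ → Matrix (Fin 2) (Fin 2) ℂ := fun l => phaseInv (if l = ι 1 then 1 else 0)
  obtain ⟨S₃, cx, cy, hcard₃, hamp₃⟩ := S₂.exists_isometry
    (fun _ => lineMap 1 D ⊗ₖ (1 : Matrix (Qubits W) (Qubits W) ℂ)) (fun _ => by
      rw [Matrix.conjTranspose_kronecker, ← Matrix.mul_kronecker_mul,
        lineMap_conjTranspose_mul _ _ fun _ => phaseInv_conjTranspose_mul _]
      simp)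
  obtain ⟨S₄, dx, dy, M₂, hcard₄, hamp₄, hM₂⟩ := exists_run hπ.inv S₃
    (fun x => ax (bx (cx x))) (fun y => ay (bY (cy y)))
  obtain ⟨S₅, ex, ey, z, hcard₅, hamp₅⟩ := S₄.exists_measure
    (fun _ z => (basisMap (lineToWire w (ι 0))).submatrix (Prod.mk z) id)
    (fun _ => sum_basisMap_submatrix (lineToWire_injective w (ι 0)))
  let px : S₅.X → S.X := fun x => ax (bx (cx (dx (ex x))))
  let py : S₅.Y → S.Y := fun y => ay (bY (cy (dy (ey y))))
  let N₁ : S₅.X → S₅.Y → Λ → Fin 2 × Fin 2 := fun x y => M₁ (cx (dx (ex x))) (cy (dy (ey y)))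
  let N₂ : S₅.X → S₅.Y → Λ → Fin 2 × Fin 2 := fun x y => M₂ (ex x) (ey y)
  obtain ⟨hg, hh⟩ := computableBit_error (X := S₅.X) (Y := S₅.Y) hι
    (f := fun x y => f (px x) (py y)) (π := fun x y => π (px x) (py y)) (M₁ := N₁) (M₂ := N₂)
    (fun x y b => hπf _ _ b) (fun θ => (hM₁ θ).comp _ _) (fun θ => (hM₂ θ).comp _ _)
  refine ⟨S₅, px, py, _, ?_, fun x y => ?_, hg, hh⟩
  -- Only the two runs, out and back, enlarge the shared register.
  · rw [hcard₅, hcard₄, hcard₃, hcard₂, hcard₁]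
    ring
  · obtain ⟨c₂, hc₂⟩ := hamp₂ (cx (dx (ex x))) (cy (dy (ey y)))
    obtain ⟨c₄, hc₄⟩ := hamp₄ (ex x) (ey y)
    rw [hamp₅, hc₄, hamp₃, hc₂, hamp₁]
    change ∃ c : ℂ, (basisMap (lineToWire w (ι 0))).submatrix (Prod.mk (z x)) id *
      (c₄ • ((lineMap (π (px x) (py y))⁻¹ (fun l => pauli (N₂ x y l)) ⊗ₖ 1) *
        ((lineMap 1 D ⊗ₖ 1) * (c₂ • ((lineMap (π (px x) (py y)) (fun l => pauli (N₁ x y l)) ⊗ₖ 1) *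
          (basisMap (wireToLine w (ι 0)) * S.amp (px x) (py y))))))) = _
    have hD : D (ι (f (px x) (py y))) = phaseInv (f (px x) (py y)) := by
      simp only [D, hι.eq_iff]
      rcases Fin.exists_fin_two.1 ⟨f (px x) (py y), rfl⟩ with h | h <;> simp [h]
    obtain ⟨c, hc⟩ := lineToWire_mul_lineMap_mul_wireToLine w (ι 0) (z x)
      ((π (px x) (py y))⁻¹ * (1 * π (px x) (py y))) (by simp)
      (fun l => pauli (N₂ x y ((1 * π (px x) (py y)) l)) *
        (D (π (px x) (py y) l) * pauli (N₁ x y l)))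
    have hmul : lineMap (π (px x) (py y))⁻¹ (fun l => pauli (N₂ x y l)) *
        (lineMap 1 D * lineMap (π (px x) (py y)) (fun l => pauli (N₁ x y l))) =
        lineMap ((π (px x) (py y))⁻¹ * (1 * π (px x) (py y)))
          (fun l => pauli (N₂ x y ((1 * π (px x) (py y)) l)) *
            (D (π (px x) (py y) l) * pauli (N₁ x y l))) := by
      rw [lineMap_mul, lineMap_mul]
    rw [← hmul] at hc
    obtain ⟨c', hc'⟩ := pauli_mul_phaseInv_mul_pauli (f (px x) (py y)) (N₁ x y (ι 0))
      (N₂ x y (ι (f (px x) (py y))))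
    rw [one_mul, hπ0, hD, hc', onWire_smul, smul_smul] at hc
    refine ⟨c₄ * c₂ * (c * c'), ?_⟩
    rw [mul_smul (c₄ * c₂), ← Matrix.smul_mul (c * c'), ← hc]
    have hk : ∀ P Q : Matrix (Qubits Λ) (Qubits Λ) ℂ,
        (P * Q) ⊗ₖ (1 : Matrix (Qubits W) (Qubits W) ℂ) = (P ⊗ₖ 1) * (Q ⊗ₖ 1) := fun P Q => by
      rw [← Matrix.mul_kronecker_mul, mul_one]
    simp only [hk, Matrix.mul_smul, Matrix.mul_assoc, smul_smul]

end Scheme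

/-! ### Gates and Pauli matrices -/

/-- The action of a CNOT gate on basis states. -/
def cnotFun {W : Type} [DecidableEq W] (c t : W) (y : Qubits W) : Qubits W :=
  Function.update y t (y t + y c)

theorem cnotFun_involutive {W : Type} [DecidableEq W] {c t : W} (hct : c ≠ t) :
    Function.Involutive (cnotFun c t) := by
  intro y
  funext v
  by_cases hv : v = t
  · subst hv
    simp only [cnotFun, Function.update_self, Function.update_of_ne hct, add_assoc]
    rcases Fin.exists_fin_two.1 ⟨y c, rfl⟩ with h | h <;> simp [h]
  · simp [cnotFun, hv]

section gates

variable {W : Type} [Fintype W] [DecidableEq W]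

theorem onWire_eq_lineMap (w : W) (M : Matrix (Fin 2) (Fin 2) ℂ) :
    onWire w M = lineMap 1 (Function.update (fun _ => 1) w M) := by
  ext x y
  simp only [onWire, lineMap, Matrix.of_apply, Equiv.Perm.coe_one, id_eq]
  rw [← Finset.mul_prod_erase _ _ (Finset.mem_univ w), Function.update_self]
  have h : ∏ v ∈ Finset.univ.erase w,
      (Function.update (fun _ => 1) w M : W → Matrix (Fin 2) (Fin 2) ℂ) v
      (x v) (y v) =
      ∏ v ∈ Finset.univ.erase w, (1 : Matrix (Fin 2) (Fin 2) ℂ) (x v) (y v) :=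
    Finset.prod_congr rfl fun v hv => by rw [Function.update_of_ne (Finset.mem_erase.1 hv).1]
  rw [h]
  split_ifs with hxy
  · rw [Finset.prod_eq_one, mul_one]
    intro v hv
    rw [hxy v (Finset.mem_erase.1 hv).1, Matrix.one_apply_eq]
  · push Not at hxy
    obtain ⟨v, hv, hne⟩ := hxy
    have h0 : (1 : Matrix (Fin 2) (Fin 2) ℂ) (x v) (y v) = 0 := Matrix.one_apply_ne hne
    rw [Finset.prod_eq_zero (Finset.mem_erase.2 ⟨hv, Finset.mem_univ v⟩) h0, mul_zero]

theorem onWire_mul (w : W) (M N : Matrix (Fin 2) (Fin 2) ℂ) :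
    onWire w M * onWire w N = onWire w (M * N) := by
  simp only [onWire_eq_lineMap, lineMap_mul, mul_one]
  congr 1
  funext v
  by_cases hv : v = w
  · subst hv; simp
  · simp [hv]

theorem onWire_conjTranspose_mul (w : W) {M : Matrix (Fin 2) (Fin 2) ℂ} (hM : Mᴴ * M = 1) :
    (onWire w M)ᴴ * onWire w M = 1 := by
  rw [onWire_eq_lineMap]
  refine lineMap_conjTranspose_mul _ _ fun v => ?_
  by_cases hv : v = w
  · subst hv; simpa using hM
  · simp [hv]

theorem onWire_mul_pauliOn {w : W} {M M' : Matrix (Fin 2) (Fin 2) ℂ} {p : W → Fin 2 × Fin 2}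
    {q : Fin 2 × Fin 2} {c : ℂ} (h : M * pauli (p w) = c • (pauli q * M')) :
    onWire w M * pauliOn p = c • (pauliOn (Function.update p w q) * onWire w M') := by
  simp only [onWire_eq_lineMap, pauliOn, lineMap_mul, mul_one]
  have hc : ∏ v, (if v = w then c else 1) = c := by simp
  conv_rhs => rw [← hc, ← lineMap_smul]
  congr 1
  funext v
  by_cases hv : v = w
  · subst hv; simpa using h
  · simp [hv]

theorem exists_addMonoidHom_of_onWire (w : W) {M : Matrix (Fin 2) (Fin 2) ℂ}
    (μ : Fin 2 × Fin 2 →+ Fin 2 × Fin 2)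
    (h : ∀ p, ∃ c : ℂ, M * pauli p = c • (pauli (μ p) * M)) :
    ∃ κ : (W → Fin 2 × Fin 2) →+ (W → Fin 2 × Fin 2), ∀ p, ∃ c : ℂ,
      onWire w M * pauliOn p = c • (pauliOn (κ p) * onWire w M) := by
  refine ⟨⟨⟨fun p => Function.update p w (μ (p w)), by simp⟩, fun p q => ?_⟩, fun p => ?_⟩
  · funext v
    by_cases hv : v = w
    · subst hv; simp
    · simp [hv]
  · obtain ⟨c, hc⟩ := h (p w)
    exact ⟨c, onWire_mul_pauliOn hc⟩

/-- With target first and control second: X spreads from control to target and Z from target to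
control. In the convention X^a Z^b no sign appears. -/
theorem pauli_mul_pauli_cnot (p q : Fin 2 × Fin 2) (s s' r r' : Fin 2) :
    pauli p (s + s') r * pauli q s' r' =
      pauli (p.1 + q.1, p.2) s (r + r') * pauli (q.1, q.2 + p.2) s' r' := by
  obtain ⟨a, b⟩ := p
  obtain ⟨a', b'⟩ := q
  have h1 : (s + s' = r + a ∧ s' = r' + a') ↔ (s = r + r' + (a + a') ∧ s' = r' + a') := by
    revert s s' r r' a a'; decide
  have h2 : b * r + b' * r' = b * (r + r') + (b' + b) * r' := by
    clear h1
    revert b b' r r'; decide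
  simp only [pauli, Matrix.of_apply, ite_mul, mul_ite, zero_mul, mul_zero, ← ite_and,
    ← bitSign_add]
  rw [h2]
  exact if_congr (by rw [and_comm, h1, and_comm]) rfl rfl

theorem exists_addMonoidHom_of_cnot {c t : W} (hct : c ≠ t) :
    ∃ κ : (W → Fin 2 × Fin 2) →+ (W → Fin 2 × Fin 2), ∀ p, ∃ z : ℂ,
      basisMap (cnotFun c t) * pauliOn p = z • (pauliOn (κ p) * basisMap (cnotFun c t)) := by
  refine ⟨⟨⟨fun p => Function.update (Function.update p t ((p t).1 + (p c).1, (p t).2)) c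
    ((p c).1, (p c).2 + (p t).2), ?_⟩, fun p q => ?_⟩, fun p => ⟨1, ?_⟩⟩
  · funext v
    by_cases hv : v = c
    · subst hv; simp
    · by_cases hv' : v = t
      · subst hv'; simp [hv]
      · simp [hv, hv']
  · funext v
    by_cases hv : v = c
    · subst hv
      simp only [Pi.add_apply, Prod.fst_add, Prod.snd_add, Function.update_self, Prod.mk_add_mk,
        Prod.mk.injEq, true_and]
      abel
    · by_cases hv' : v = t
      · subst hv'
        simp only [Pi.add_apply, Prod.fst_add, Prod.snd_add, Function.update_self,
          Function.update_of_ne hv, Prod.mk_add_mk, Prod.mk.injEq, and_true]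
        abel
      · simp [hv, hv']
  · rw [one_smul]
    ext s r
    have hs : ∀ u, s = cnotFun c t u ↔ u = cnotFun c t s := fun u =>
      ⟨fun h => by rw [h, cnotFun_involutive hct], fun h => by rw [h, cnotFun_involutive hct]⟩
    simp only [Matrix.mul_apply, basisMap, Matrix.of_apply, ite_mul, one_mul, zero_mul, mul_ite,
      mul_one, mul_zero, hs, Finset.sum_ite_eq', Finset.mem_univ, if_true, pauliOn, lineMap,
      Equiv.Perm.coe_one, id_eq, AddMonoidHom.coe_mk, ZeroHom.coe_mk]
    have htc : t ∈ Finset.univ.erase c := Finset.mem_erase.2 ⟨hct.symm, Finset.mem_univ t⟩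
    rw [← Finset.mul_prod_erase _ _ (Finset.mem_univ c), ← Finset.mul_prod_erase _ _ htc,
      ← Finset.mul_prod_erase _ _ (Finset.mem_univ c), ← Finset.mul_prod_erase _ _ htc,
      ← mul_assoc, ← mul_assoc]
    refine congrArg₂ (· * ·) ?_ (Finset.prod_congr rfl fun v hv => ?_)
    · simp only [cnotFun, Function.update_self, Function.update_of_ne hct,
        Function.update_of_ne hct.symm]
      rw [mul_comm, pauli_mul_pauli_cnot, mul_comm]
    · simp only [Finset.mem_erase] at hv
      simp [cnotFun, hv.1, hv.2.1]

theorem Gate.matrix_conjTranspose_mul (g : Gate W) : g.matrixᴴ * g.matrix = 1 := by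
  cases g with
  | X w =>
    refine onWire_conjTranspose_mul w ?_
    ext i j; fin_cases i <;> fin_cases j <;> simp [Matrix.mul_apply]
  | Z w =>
    refine onWire_conjTranspose_mul w ?_
    ext i j; fin_cases i <;> fin_cases j <;> simp [Matrix.mul_apply]
  | H w =>
    refine onWire_conjTranspose_mul w ?_
    have h : ((Real.sqrt 2 : ℝ) : ℂ)⁻¹ * ((Real.sqrt 2 : ℝ) : ℂ)⁻¹ = 1 / 2 := by
      rw [← mul_inv, ← Complex.ofReal_mul, Real.mul_self_sqrt (by norm_num)]
      norm_num
    ext i j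
    fin_cases i <;> fin_cases j <;>
      simp [Matrix.mul_apply, h, Complex.conj_ofReal] <;> norm_num
  | P w =>
    refine onWire_conjTranspose_mul w ?_
    ext i j; fin_cases i <;> fin_cases j <;> simp [Matrix.mul_apply]
  | CNOT c t hct => exact basisMap_conjTranspose_mul (cnotFun_involutive hct).injective
  | T w =>
    refine onWire_conjTranspose_mul w ?_
    ext i j
    fin_cases i <;> fin_cases j <;> simp [Matrix.mul_apply]
    rw [← Complex.exp_conj, ← Complex.exp_add]
    have h4 : (starRingEnd ℂ) 4 = 4 := Complex.conj_ofNat 4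
    simp [h4, neg_div]

/-- Clifford gates map Pauli matrices to Pauli matrices. -/
theorem Gate.exists_addMonoidHom {g : Gate W} (hg : g.IsClifford) :
    ∃ κ : (W → Fin 2 × Fin 2) →+ (W → Fin 2 × Fin 2), ∀ p, ∃ c : ℂ,
      g.matrix * pauliOn p = c • (pauliOn (κ p) * g.matrix) := by
  cases g with
  | X w =>
    refine exists_addMonoidHom_of_onWire w (AddMonoidHom.id _) ?_
    rintro ⟨a, b⟩
    refine ⟨bitSign b, ?_⟩
    ext i j
    fin_cases a <;> fin_cases b <;> fin_cases i <;> fin_cases j <;>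
      simp [Matrix.mul_apply, pauli, bitSign]
  | Z w =>
    refine exists_addMonoidHom_of_onWire w (AddMonoidHom.id _) ?_
    rintro ⟨a, b⟩
    refine ⟨bitSign a, ?_⟩
    ext i j
    fin_cases a <;> fin_cases b <;> fin_cases i <;> fin_cases j <;>
      simp [Matrix.mul_apply, pauli, bitSign]
  | H w =>
    refine exists_addMonoidHom_of_onWire w
      ((AddMonoidHom.snd (Fin 2) (Fin 2)).prod (AddMonoidHom.fst (Fin 2) (Fin 2))) ?_
    rintro ⟨a, b⟩
    refine ⟨bitSign (a * b), ?_⟩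
    ext i j
    fin_cases a <;> fin_cases b <;> fin_cases i <;> fin_cases j <;>
      simp [Matrix.mul_apply, pauli, bitSign]
  | P w =>
    refine exists_addMonoidHom_of_onWire w ((AddMonoidHom.fst (Fin 2) (Fin 2)).prod
      (AddMonoidHom.fst (Fin 2) (Fin 2) + AddMonoidHom.snd (Fin 2) (Fin 2))) ?_
    rintro ⟨a, b⟩
    refine ⟨if a = 1 then Complex.I else 1, ?_⟩
    ext i j
    fin_cases a <;> fin_cases b <;> fin_cases i <;> fin_cases j <;>
      simp [Matrix.mul_apply, pauli, bitSign]
  | CNOT c t hct => exact exists_addMonoidHom_of_cnot hct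
  | T w => exact hg.elim

/-- A T gate maps `X^a Z^b` to `P^a X^a Z^b`. -/
theorem phaseInv_mul_T_mul_pauli (p : Fin 2 × Fin 2) :
    ∃ c : ℂ, phaseInv p.1 * !![1, 0; 0, Complex.exp (Complex.I * Real.pi / 4)] * pauli p =
      c • (pauli p * !![1, 0; 0, Complex.exp (Complex.I * Real.pi / 4)]) := by
  have h : Complex.exp (Complex.I * Real.pi / 4) * Complex.exp (Complex.I * Real.pi / 4) =
      Complex.I := by
    rw [← Complex.exp_add]
    refine Eq.trans (congrArg Complex.exp ?_) Complex.exp_pi_div_two_mul_I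
    ring
  generalize Complex.exp (Complex.I * Real.pi / 4) = ω at h
  have h' : Complex.I * ω * ω = -1 := by rw [mul_assoc, h, Complex.I_mul_I]
  obtain ⟨a, b⟩ := p
  -- For a = 1 the two off-diagonal entries require c = -iω and cω = 1, which agree since ω² = i.
  refine ⟨if a = 1 then -Complex.I * ω else 1, ?_⟩
  ext i j
  fin_cases a <;> fin_cases b <;> fin_cases i <;> fin_cases j <;>
    simp [Matrix.mul_apply, phaseInv, pauli, bitSign, h']

/-! ### Exchanging gates on disjoint sets of wires -/

/-- `IsLocal G s`: the operator `G` acts on the wires in `s` only. -/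
def IsLocal (G : Matrix (Qubits W) (Qubits W) ℂ) (s : Set W) : Prop :=
  (∀ x y, (∃ v, v ∉ s ∧ x v ≠ y v) → G x y = 0) ∧
  ∀ x y x' y', (∀ v ∈ s, x v = x' v ∧ y v = y' v) → (∀ v, v ∉ s → x v = y v) →
    (∀ v, v ∉ s → x' v = y' v) → G x y = G x' y'

/-- In the sum for an entry of the product only one intermediate basis state survives: it agrees
with the column index on `s` and with the row index elsewhere. -/
theorem IsLocal.commute {G H : Matrix (Qubits W) (Qubits W) ℂ} {s t : Set W} (hG : IsLocal G s)
    (hH : IsLocal H t) (hst : Disjoint s t) : G * H = H * G := by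
  classical
  have key : ∀ {G H : Matrix (Qubits W) (Qubits W) ℂ} {s t : Set W}, IsLocal G s → IsLocal H t →
      Disjoint s t → ∀ x y, (G * H) x y =
        G x (fun v => if v ∈ s then y v else x v) * H (fun v => if v ∈ s then y v else x v) y := by
    intro G H s t hG hH hst x y
    rw [Matrix.mul_apply]
    refine Finset.sum_eq_single _ (fun z _ hz => ?_) (by simp)
    obtain ⟨v, hv⟩ := Function.ne_iff.1 hz
    by_cases hs : v ∈ s
    · rw [hH.1 z y ⟨v, hst.notMem_of_mem_left hs, by simpa [hs] using hv⟩, mul_zero]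
    · rw [hG.1 x z ⟨v, hs, by simpa [hs] using hv.symm⟩, zero_mul]
  ext x y
  rw [key hG hH hst, key hH hG hst.symm]
  by_cases hxy : ∀ v, v ∉ s → v ∉ t → x v = y v
  · rw [mul_comm]
    refine congrArg₂ (· * ·) (hH.2 _ _ _ _ ?_ ?_ ?_) (hG.2 _ _ _ _ ?_ ?_ ?_)
    · intro v hv
      simp [hv, hst.notMem_of_mem_right hv]
    · intro v hv
      by_cases hs : v ∈ s
      · simp [hs]
      · simpa [hs] using hxy v hs hv
    · intro v hv; simp [hv]
    · intro v hv
      simp [hv, hst.notMem_of_mem_left hv]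
    · intro v hv; simp [hv]
    · intro v hv
      by_cases ht : v ∈ t
      · simp [ht]
      · simpa [ht] using hxy v hv ht
  · push Not at hxy
    obtain ⟨v, hs, ht, hne⟩ := hxy
    rw [hH.1 _ y ⟨v, ht, by simpa [hs] using hne⟩, hG.1 _ y ⟨v, hs, by simpa [ht] using hne⟩,
      mul_zero, mul_zero]

theorem isLocal_onWire (w : W) (M : Matrix (Fin 2) (Fin 2) ℂ) : IsLocal (onWire w M) {w} := by
  constructor
  · rintro x y ⟨v, hv, hne⟩
    exact if_neg fun h => hne (h v hv)
  · intro x y x' y' h h1 h2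
    simp only [onWire, Matrix.of_apply]
    exact if_congr ⟨fun _ => h2, fun _ => h1⟩ (by rw [(h w rfl).1, (h w rfl).2]) rfl

theorem Gate.isLocal_matrix (g : Gate W) : IsLocal g.matrix g.wires := by
  cases g with
  | X w => exact isLocal_onWire _ _
  | Z w => exact isLocal_onWire _ _
  | H w => exact isLocal_onWire _ _
  | P w => exact isLocal_onWire _ _
  | T w => exact isLocal_onWire _ _
  | CNOT c t hct =>
    constructor
    · rintro x y ⟨v, hv, hne⟩
      refine if_neg fun h => hne ?_
      have hvt : v ≠ t := fun h => hv (by simp [Gate.wires, h])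
      rw [h, Function.update_of_ne hvt]
    · intro x y x' y' h h1 h2
      have hc := h c (by simp [Gate.wires])
      have ht := h t (by simp [Gate.wires])
      have key : ∀ x y : Qubits W, (∀ v, v ∉ Gate.wires (.CNOT c t hct) → x v = y v) →
          (x = Function.update y t (y t + y c) ↔ x c = y c ∧ x t = y t + y c) := by
        intro x y hxy
        constructor
        · rintro h
          rw [h]
          simp [hct]
        · rintro ⟨hc, ht⟩
          funext v
          by_cases hvt : v = t
          · subst hvt; simpa using ht
          · rw [Function.update_of_ne hvt]
            by_cases hvc : v = c
            · subst hvc; exact hc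
            · exact hxy v (by simp [Gate.wires, hvc, hvt])
      simp only [Gate.matrix, Matrix.of_apply]
      exact if_congr (by rw [key x y h1, key x' y' h2, hc.1, hc.2, ht.1, ht.2]) rfl rfl

theorem Circuit.unitary_append (C D : Circuit W) :
    Circuit.unitary (C ++ D) = Circuit.unitary D * Circuit.unitary C := by
  induction C with
  | nil => simp [Circuit.unitary]
  | cons g C ih => simp only [List.cons_append, Circuit.unitary, ih, Matrix.mul_assoc]

theorem Circuit.unitary_conjTranspose_mul (C : Circuit W) :
    (Circuit.unitary C)ᴴ * Circuit.unitary C = 1 := by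
  induction C with
  | nil => simp [Circuit.unitary]
  | cons g C ih =>
    rw [Circuit.unitary, Matrix.conjTranspose_mul, Matrix.mul_assoc,
      ← Matrix.mul_assoc (Circuit.unitary C)ᴴ, ih, Matrix.one_mul, g.matrix_conjTranspose_mul]

/-- T-depth is attained by some reordering of the gates, so the protocol is built for that
reordering and transferred back. -/
theorem Circuit.Same.unitary_eq {C D : Circuit W} (h : Circuit.Same C D) :
    C.unitary = D.unitary := by
  induction h with
  | rel C D h =>
    obtain ⟨C, D, g, h, hgh⟩ := h
    simp only [Circuit.unitary_append, Circuit.unitary, Matrix.mul_assoc]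
    rw [← Matrix.mul_assoc h.matrix, ← Matrix.mul_assoc g.matrix,
      h.isLocal_matrix.commute g.isLocal_matrix hgh.symm]
  | refl => rfl
  | symm _ _ _ ih => exact ih.symm
  | trans _ _ _ _ _ ih ih' => exact ih.trans ih'

end gates

/-! ### Performing a circuit up to Pauli errors -/

namespace Scheme

/-- Both bits of the Pauli error on wire `w` are computable in `r` rounds on the lines `Λ`. -/
def ComputableKey {X Y W : Type} (Λ : Type) (r : ℕ) (key : X → Y → W → Fin 2 × Fin 2) (w : W) :
    Prop :=
  ComputableBit Λ r (fun x y => (key x y w).1) ∧ ComputableBit Λ r (fun x y => (key x y w).2)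

/-- Every linear functional of the Pauli error is computable in `r` rounds on the lines `Λ`. -/
def ComputableLinear {X Y W : Type} (Λ : Type) (r : ℕ) (key : X → Y → W → Fin 2 × Fin 2) : Prop :=
  ∀ φ : (W → Fin 2 × Fin 2) →+ Fin 2, ComputableBit Λ r (fun x y => φ (key x y))

theorem ComputableLinear.computableKey {X Y W Λ : Type} {r : ℕ}
    {key : X → Y → W → Fin 2 × Fin 2} (h : ComputableLinear Λ r key) (w : W) :
    ComputableKey Λ r key w :=
  ⟨h ((AddMonoidHom.fst _ _).comp (Pi.evalAddMonoidHom _ w)),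
    h ((AddMonoidHom.snd _ _).comp (Pi.evalAddMonoidHom _ w))⟩

variable {A B W : Type} [Fintype A] [Fintype B] [DecidableEq A] [DecidableEq B] [Fintype W]
  [DecidableEq W]

/-- The scheme performs `V`, up to the Pauli error `key x y`. -/
def Realizes (S : Scheme A B (Qubits W)) (key : S.X → S.Y → W → Fin 2 × Fin 2)
    (V : Matrix (Qubits W) (A × B) ℂ) : Prop :=
  ∀ x y, ∃ c : ℂ, S.amp x y = c • (pauliOn (key x y) * V)

/-- Moving T past the key leaves P to the power of the X bit on `w`. That bit is computable, so
`exists_phaseInv` removes the factor; only the key on `w` changes. -/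
theorem Realizes.exists_T {Λ : Type} [Fintype Λ] {S : Scheme A B (Qubits W)}
    {key : S.X → S.Y → W → Fin 2 × Fin 2} {V : Matrix (Qubits W) (A × B) ℂ}
    (hS : S.Realizes key V) {w : W} {r : ℕ} (hw : ComputableKey Λ r key w) :
    ∃ (S' : Scheme A B (Qubits W)) (qx : S'.X → S.X) (qy : S'.Y → S.Y)
      (k : S'.X → S'.Y → Fin 2 × Fin 2),
      Fintype.card S'.E = Fintype.card S.E * 2 ^ (4 * Fintype.card Λ * r) ∧
      S'.Realizes (fun x y => Function.update (key (qx x) (qy y)) w (k x y))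
        ((Gate.T w).matrix * V) ∧
      ComputableBit (Λ × (Fin 2 × Fin 2)) (5 * r) (fun x y => (k x y).1) ∧
      ComputableBit (Λ × (Fin 2 × Fin 2)) (5 * r) (fun x y => (k x y).2) := by
  obtain ⟨S₁, ax, ay, hcard₁, hamp₁⟩ := S.exists_isometry (fun _ => (Gate.T w).matrix)
    (fun _ => (Gate.T w).matrix_conjTranspose_mul)
  obtain ⟨S₂, bx, bY, δ, hcard₂, hamp₂, hx, hz⟩ := S₁.exists_phaseInv w (hw.1.comp ax ay)
  refine ⟨S₂, fun x => ax (bx x), fun y => ay (bY y),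
    fun x y => δ x y + key (ax (bx x)) (ay (bY y)) w, by rw [hcard₂, hcard₁], fun x y => ?_, ?_, ?_⟩
  · change ∃ c : ℂ, _ = c • (pauliOn (Function.update (key (ax (bx x)) (ay (bY y))) w
      (δ x y + key (ax (bx x)) (ay (bY y)) w)) * ((Gate.T w).matrix * V))
    obtain ⟨c₂, hc₂⟩ := hamp₂ x y
    obtain ⟨c₁, hc₁⟩ := hS (ax (bx x)) (ay (bY y))
    rw [hc₂, hamp₁, hc₁]
    generalize key (ax (bx x)) (ay (bY y)) = p
    obtain ⟨c, hc⟩ := phaseInv_mul_T_mul_pauli (p w)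
    have h : pauli (δ x y) * phaseInv (p w).1 *
        !![1, 0; 0, Complex.exp (Complex.I * Real.pi / 4)] * pauli (p w) =
        (c * bitSign ((δ x y).2 * (p w).1)) • (pauli (δ x y + p w) *
          !![1, 0; 0, Complex.exp (Complex.I * Real.pi / 4)]) := by
      rw [Matrix.mul_assoc, Matrix.mul_assoc, ← Matrix.mul_assoc (phaseInv _), hc,
        Matrix.mul_smul, ← Matrix.mul_assoc, pauli_mul, Matrix.smul_mul, smul_smul]
    refine ⟨c₂ * c₁ * (c * bitSign ((δ x y).2 * (p w).1)), ?_⟩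
    have h2 : onWire w (pauli (δ x y) * phaseInv (p w).1) *
        ((Gate.T w).matrix * (pauliOn p * V)) =
        onWire w (pauli (δ x y) * phaseInv (p w).1 *
          !![1, 0; 0, Complex.exp (Complex.I * Real.pi / 4)]) * pauliOn p * V := by
      rw [← onWire_mul w (pauli (δ x y) * phaseInv (p w).1), Matrix.mul_assoc, Matrix.mul_assoc]
      rfl
    rw [Matrix.mul_smul, Matrix.mul_smul, h2, onWire_mul_pauliOn h, smul_smul, Matrix.smul_mul,
      smul_smul, Matrix.mul_assoc]
    rfl
  -- The old key bit costs r more rounds: 2r + r for X here and 4r + r for Z below, both at most 5r.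
  · have := hx.add ((hw.1.comp (fun x => ax (bx x)) (fun y => ay (bY y))).lift
      (G := Fin 2 × Fin 2))
    exact this.mono (by omega)
  · have := hz.add ((hw.2.comp (fun x => ax (bx x)) (fun y => ay (bY y))).lift
      (G := Fin 2 × Fin 2))
    exact this.mono (by omega)

/-- A T gate leaves the keys of other wires alone, so wires still waiting keep their cheap keys on
`Λ`, and the costs within a layer add instead of multiplying. -/
theorem exists_layer {Λ : Type} [Fintype Λ] {r : ℕ} :
    ∀ (ws : List W) (_ : ws.Nodup) (S : Scheme A B (Qubits W))
      (key : S.X → S.Y → W → Fin 2 × Fin 2) (V : Matrix (Qubits W) (A × B) ℂ),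
      S.Realizes key V → (∀ w ∈ ws, ComputableKey Λ r key w) →
      (∀ w, w ∉ ws → ComputableKey (Λ × (Fin 2 × Fin 2)) (5 * r) key w) →
      ∃ (S' : Scheme A B (Qubits W)) (key' : S'.X → S'.Y → W → Fin 2 × Fin 2),
        Fintype.card S'.E = Fintype.card S.E * 2 ^ (ws.length * (4 * Fintype.card Λ * r)) ∧
        S'.Realizes key' (Circuit.unitary (ws.map Gate.T) * V) ∧
        ∀ w, ComputableKey (Λ × (Fin 2 × Fin 2)) (5 * r) key' w := by
  intro ws
  induction ws with
  | nil =>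
    intro _ S key V hS _ h
    exact ⟨S, key, by simp, by simpa [Circuit.unitary] using hS, fun w => h w (by simp)⟩
  | cons w ws ih =>
    intro hnd S key V hS hin hout
    obtain ⟨hw, hnd⟩ := List.nodup_cons.1 hnd
    obtain ⟨S₁, qx, qy, k, hcard₁, hS₁, hkx, hkz⟩ := hS.exists_T (hin w (by simp))
    have hin' : ∀ v ∈ ws, ComputableKey Λ r
        (fun x y => Function.update (key (qx x) (qy y)) w (k x y)) v := by
      intro v hv
      have hvw : v ≠ w := fun h => hw (h ▸ hv)
      obtain ⟨h1, h2⟩ := hin v (List.mem_cons_of_mem _ hv)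
      unfold ComputableKey
      simp only [Function.update_of_ne hvw]
      exact ⟨h1.comp qx qy, h2.comp qx qy⟩
    have hout' : ∀ v, v ∉ ws → ComputableKey (Λ × (Fin 2 × Fin 2)) (5 * r)
        (fun x y => Function.update (key (qx x) (qy y)) w (k x y)) v := by
      intro v hv
      unfold ComputableKey
      by_cases hvw : v = w
      · subst hvw
        simp only [Function.update_self]
        exact ⟨hkx, hkz⟩
      · obtain ⟨h1, h2⟩ := hout v (by simp [hvw, hv])
        simp only [Function.update_of_ne hvw]
        exact ⟨h1.comp qx qy, h2.comp qx qy⟩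
    obtain ⟨S₂, key₂, hcard₂, hS₂, hkey₂⟩ := ih hnd S₁ _ _ hS₁ hin' hout'
    refine ⟨S₂, key₂, ?_, ?_, hkey₂⟩
    · rw [hcard₂, hcard₁, List.length_cons]
      ring
    · rw [List.map_cons, Circuit.unitary, Matrix.mul_assoc]
      exact hS₂

/-- A functional of the key is a sum of functionals of its single bits, two per wire. The injective
pair `ι` is needed for the empty sum. -/
theorem ComputableLinear.of_computableKey {X Y Λ : Type} {r : ℕ}
    {key : X → Y → W → Fin 2 × Fin 2} {ι : Fin 2 → Λ} (hι : Function.Injective ι)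
    (h : ∀ w, ComputableKey Λ r key w) :
    ComputableLinear Λ (Fintype.card W * (r + r)) key := by
  intro φ
  have hsum : (fun x y => φ (key x y)) = fun x y => ∑ w,
      (φ (Pi.single w ((key x y w).1, 0)) + φ (Pi.single w (0, (key x y w).2))) := by
    funext x y
    conv_lhs => rw [← Finset.univ_sum_single (key x y), map_sum]
    refine Finset.sum_congr rfl fun w _ => ?_
    rw [← map_add, ← Pi.single_add]
    simp
  rw [hsum]
  exact ComputableBit.sum Finset.univ hι fun w =>
    ((h w).1.addMonoidHom_comp (φ.comp ((AddMonoidHom.single _ w).comp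
      (AddMonoidHom.inl (Fin 2) (Fin 2))))).add
    ((h w).2.addMonoidHom_comp (φ.comp ((AddMonoidHom.single _ w).comp
      (AddMonoidHom.inr (Fin 2) (Fin 2)))))

/-- A Clifford gate changes the key by an additive map, and functionals composed with it are
functionals again. For this reason all functionals are controlled, and a whole block of Clifford
gates costs nothing. -/
theorem Realizes.exists_clifford {Λ : Type} {r : ℕ} {K : Circuit W} (hK : ∀ g ∈ K, g.IsClifford) :
    ∀ {S : Scheme A B (Qubits W)} {key : S.X → S.Y → W → Fin 2 × Fin 2}
      {V : Matrix (Qubits W) (A × B) ℂ}, S.Realizes key V → ComputableLinear Λ r key →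
      ∃ (S' : Scheme A B (Qubits W)) (key' : S'.X → S'.Y → W → Fin 2 × Fin 2),
        Fintype.card S'.E = Fintype.card S.E ∧ S'.Realizes key' (Circuit.unitary K * V) ∧
        ComputableLinear Λ r key' := by
  induction K with
  | nil =>
    intro S key V hS hkey
    exact ⟨S, key, rfl, by simpa [Circuit.unitary] using hS, hkey⟩
  | cons g K ih =>
    intro S key V hS hkey
    obtain ⟨κ, hκ⟩ := Gate.exists_addMonoidHom (hK g (by simp))
    obtain ⟨S₁, qx, qy, hcard₁, hamp₁⟩ := S.exists_isometry (fun _ => g.matrix)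
      (fun _ => g.matrix_conjTranspose_mul)
    have hS₁ : S₁.Realizes (fun x y => κ (key (qx x) (qy y))) (g.matrix * V) := by
      intro x y
      obtain ⟨c₁, hc₁⟩ := hS (qx x) (qy y)
      obtain ⟨c, hc⟩ := hκ (key (qx x) (qy y))
      refine ⟨c₁ * c, ?_⟩
      rw [hamp₁, hc₁, Matrix.mul_smul, ← Matrix.mul_assoc, hc, Matrix.smul_mul, smul_smul,
        Matrix.mul_assoc]
    obtain ⟨S₂, key₂, hcard₂, hS₂, hkey₂⟩ := ih (fun g hg => hK g (by simp [hg])) hS₁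
      (fun φ => (hkey (φ.comp κ)).comp qx qy)
    refine ⟨S₂, key₂, hcard₂.trans hcard₁, ?_, hkey₂⟩
    rw [Circuit.unitary, Matrix.mul_assoc]
    exact hS₂

/-! ### The initial teleportation and the number of EPR pairs -/

theorem pauliOn_sum {m : ℕ} (p : Fin m ⊕ Fin m → Fin 2 × Fin 2) (s r : Qubits (Fin m ⊕ Fin m)) :
    pauliOn p s r = pauliOn (p ∘ Sum.inl) (s ∘ Sum.inl) (r ∘ Sum.inl) *
      pauliOn (p ∘ Sum.inr) (s ∘ Sum.inr) (r ∘ Sum.inr) :=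
  Fintype.prod_sum_type fun i => pauli (p i) (s i) (r i)

/-- The input register of the two players as a register of `m + m` qubits. -/
def inputMap (m : ℕ) : Matrix (Qubits (Fin m ⊕ Fin m)) (Qubits (Fin m) × Qubits (Fin m)) ℂ :=
  basisMap fun p => Sum.elim p.1 p.2

/-- Bob teleports his qubits to Alice. -/
noncomputable def teleportInput (m : ℕ) :
    Scheme (Qubits (Fin m)) (Qubits (Fin m)) (Qubits (Fin m ⊕ Fin m)) where
  X := Unit
  Y := Fin m → Fin 2 × Fin 2
  E := Qubits (Fin m)
  K _ := inputMap m
  L v q := teleportScalar (Qubits (Fin m)) * pauliOn v q.2 q.1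
  complete_K := by
    simp only [Finset.univ_unique, Finset.sum_singleton]
    refine basisMap_conjTranspose_mul fun p q h => ?_
    refine Prod.ext (funext fun i => ?_) (funext fun i => ?_)
    · exact congrFun h (Sum.inl i)
    · exact congrFun h (Sum.inr i)
  complete_L := by
    rintro ⟨b, e⟩ ⟨b', e'⟩
    have h1 : ∀ v : Fin m → Fin 2 × Fin 2,
        star (teleportScalar (Qubits (Fin m)) * pauliOn v e b) *
        (teleportScalar (Qubits (Fin m)) * pauliOn v e' b') =
        star (teleportScalar (Qubits (Fin m))) * teleportScalar (Qubits (Fin m)) *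
        (star (pauliOn v e b) * pauliOn v e' b') := by
      intro v
      rw [star_mul']
      ring
    have h2 : ∑ v : Fin m → Fin 2 × Fin 2, star (pauliOn v e b) * pauliOn v e' b' = _ :=
      isOperatorBasis_lineMap_pauli (1 : Equiv.Perm (Fin m)) e b e' b'
    simp only [h1, ← Finset.mul_sum]
    rw [h2]
    by_cases h : e = e' ∧ b = b'
    · rw [if_pos h, if_pos (by rw [h.1, h.2]), star_teleportScalar_mul]
    · rw [if_neg h, if_neg (by simp only [Prod.mk.injEq]; tauto), mul_zero]

/-- Alice's own wires carry no error, and the key on Bob's wires is his outcome. -/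
theorem teleportInput_realizes (m : ℕ) :
    (teleportInput m).Realizes
      (fun _ (v : Fin m → Fin 2 × Fin 2) => Sum.elim (fun _ => 0) v) (inputMap m) := by
  intro x (v : Fin m → Fin 2 × Fin 2)
  refine ⟨teleportScalar (Qubits (Fin m)), ?_⟩
  ext s ⟨a, b⟩
  have h1 : (teleportInput m).amp x v s (a, b) = ∑ e : Qubits (Fin m),
      (if s = Sum.elim a e then 1 else 0) * (teleportScalar (Qubits (Fin m)) * pauliOn v e b) := rfl
  have h2 : ∀ Q : Matrix (Qubits (Fin m ⊕ Fin m)) (Qubits (Fin m ⊕ Fin m)) ℂ,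
      (Q * inputMap m) s (a, b) = Q s (Sum.elim a b) := by
    intro Q
    rw [Matrix.mul_apply]
    simp [inputMap, basisMap]
  have h3 : ∀ e, s = Sum.elim a e ↔ s ∘ Sum.inl = a ∧ e = s ∘ Sum.inr := by
    intro e
    constructor
    · rintro rfl
      simp
    · rintro ⟨rfl, rfl⟩
      simp
  have h4 : pauliOn (Sum.elim (fun _ => 0) v) s (Sum.elim a b) =
      (if s ∘ Sum.inl = a then 1 else 0) * pauliOn v (s ∘ Sum.inr) b := by
    rw [pauliOn_sum]
    change pauliOn 0 (s ∘ Sum.inl) a * _ = _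
    rw [pauliOn_zero, Matrix.one_apply]
    rfl
  change _ = teleportScalar (Qubits (Fin m)) *
    (pauliOn (Sum.elim (fun _ => 0) v) * inputMap m :
      Matrix (Qubits (Fin m ⊕ Fin m)) (Qubits (Fin m) × Qubits (Fin m)) ℂ) s (a, b)
  rw [h1, h2, h4]
  simp only [h3, ite_and, ite_mul, zero_mul, one_mul]
  split_ifs <;> simp

/-- Number of EPR pairs used for the first `d` layers on `2 * m` wires. -/
def pairs (m d : ℕ) : ℕ := m + 8 * (2 * m) * ∑ t ∈ Finset.range d, (40 * (2 * m)) ^ t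

/-- With n = 2m, one more layer multiplies the bound by at most 1 + 8n ≤ 68n. The induction starts
at depth 1, since m pairs are used even without layers. -/
theorem pairs_le (m : ℕ) {d : ℕ} (hd : 1 ≤ d) : pairs m d ≤ (68 * (2 * m)) ^ d := by
  induction d, hd using Nat.le_induction with
  | base => simp [pairs]; omega
  | succ d hd ih =>
    have h : pairs m (d + 1) = pairs m d + 8 * (2 * m) * (40 * (2 * m)) ^ d := by
      rw [pairs, pairs, Finset.sum_range_succ]; ring
    have h40 : (40 * (2 * m)) ^ d ≤ (68 * (2 * m)) ^ d := Nat.pow_le_pow_left (by omega) d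
    rw [h, pow_succ]
    -- The inequality 1 + 8n ≤ 68n fails for n = 0, where no pairs are used.
    rcases Nat.eq_zero_or_pos m with rfl | hm
    · simp [pairs]
    · calc pairs m d + 8 * (2 * m) * (40 * (2 * m)) ^ d
          ≤ (68 * (2 * m)) ^ d + 8 * (2 * m) * (68 * (2 * m)) ^ d :=
            Nat.add_le_add ih (Nat.mul_le_mul_left _ h40)
        _ = (68 * (2 * m)) ^ d * (1 + 8 * (2 * m)) := by ring
        _ ≤ (68 * (2 * m)) ^ d * (68 * (2 * m)) := Nat.mul_le_mul_left _ (by omega)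

/-- A circuit with `d` layers of T gates is performed on Alice's side, up to Pauli errors. -/
theorem exists_realizes {m d : ℕ} {C : Circuit (Fin m ⊕ Fin m)} (hC : Circuit.HasLayers d C) :
    ∃ (S : Scheme (Qubits (Fin m)) (Qubits (Fin m)) (Qubits (Fin m ⊕ Fin m)))
      (key : S.X → S.Y → Fin m ⊕ Fin m → Fin 2 × Fin 2) (k : ℕ) (Λ : Type) (_ : Fintype Λ),
      k ≤ pairs m d ∧ Fintype.card S.E = 2 ^ k ∧ Fintype.card Λ = 2 * 4 ^ d ∧
      S.Realizes key (C.unitary * inputMap m) ∧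
      ComputableLinear Λ ((10 * (2 * m)) ^ d) key := by
  induction hC with
  | clifford C hC =>
    -- The first key depends on Bob's outcome alone, so one round on two lines computes any
    -- functional of it.
    obtain ⟨S, key, hcard, hS, hkey⟩ := (teleportInput_realizes m).exists_clifford hC
      (Λ := Fin 2) (r := 1) fun φ =>
        ComputableBit.of_bob fun v : Fin m → Fin 2 × Fin 2 => φ (Sum.elim (fun _ => 0) v)
    refine ⟨S, key, m, Fin 2, inferInstance, by simp [pairs], ?_, by simp, hS, hkey⟩
    rw [hcard]
    change Fintype.card (Fin m → Fin 2) = 2 ^ m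
    simp
  | layer d C ws K hC hws hK ih =>
    obtain ⟨S, key, k, Λ, _, hk, hcard, hΛ, hS, hkey⟩ := ih
    obtain ⟨S₁, key₁, hcard₁, hS₁, hkey₁⟩ := exists_layer ws hws S key _ hS
      (fun w _ => hkey.computableKey w) (fun w _ => by
        obtain ⟨h1, h2⟩ := hkey.computableKey w
        exact ⟨h1.lift.mono (by omega), h2.lift.mono (by omega)⟩)
    -- The zero functional serves only to supply two distinct lines.
    obtain ⟨ι, hι, -⟩ := hkey 0
    have hlin := ComputableLinear.of_computableKey (ι := fun b => (ι b, (0 : Fin 2 × Fin 2)))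
      (fun a b h => hι (congrArg Prod.fst h)) hkey₁
    obtain ⟨S₂, key₂, hcard₂, hS₂, hkey₂⟩ := hS₁.exists_clifford hK hlin
    refine ⟨S₂, key₂, k + ws.length * (4 * Fintype.card Λ * (10 * (2 * m)) ^ d),
      Λ × (Fin 2 × Fin 2), inferInstance, ?_, ?_, ?_, ?_, ?_⟩
    · have hlen : ws.length ≤ 2 * m := by
        simpa [two_mul] using hws.length_le_card
      calc _ ≤ pairs m d + 2 * m * (4 * Fintype.card Λ * (10 * (2 * m)) ^ d) :=
            Nat.add_le_add hk (Nat.mul_le_mul_right _ hlen)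
        _ = pairs m (d + 1) := by
            rw [pairs, pairs, Finset.sum_range_succ, hΛ,
              show 40 * (2 * m) = 4 * (10 * (2 * m)) by ring, mul_pow 4 (10 * (2 * m)) d]
            ring
    · rw [hcard₂, hcard₁, hcard, pow_add]
    · simp only [Fintype.card_prod, Fintype.card_fin, hΛ]
      ring
    · rw [Circuit.unitary_append, Circuit.unitary_append, Matrix.mul_assoc, Matrix.mul_assoc]
      exact hS₂
    · have hr : Fintype.card (Fin m ⊕ Fin m) * (5 * (10 * (2 * m)) ^ d + 5 * (10 * (2 * m)) ^ d) =
          (10 * (2 * m)) ^ (d + 1) := by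
        simp only [Fintype.card_sum, Fintype.card_fin]
        ring
      rwa [hr] at hkey₂

end Scheme

/-! ### Quantum operations given by Kraus operators -/

/-- The map `ρ ↦ ∑ i, K i * ρ * (K i)ᴴ`. -/
def krausMap {ι a b : Type} [Fintype ι] [Fintype a] (K : ι → Matrix b a ℂ) :
    Matrix a a ℂ →ₗ[ℂ] Matrix b b ℂ where
  toFun ρ := ∑ i, K i * ρ * (K i)ᴴ
  map_add' ρ σ := by simp only [Matrix.mul_add, Matrix.add_mul, Finset.sum_add_distrib]
  map_smul' c ρ := by
    simp only [Matrix.mul_smul, Matrix.smul_mul, RingHom.id_apply, Finset.smul_sum]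

/-- By linearity it suffices to compare on matrix units, which are Kronecker products of matrix
units. -/
theorem tensorMap_krausMap {ι κ a b a' b' : Type} [Fintype ι] [Fintype κ] [Fintype a] [Fintype b]
    (K : ι → Matrix a' a ℂ) (L : κ → Matrix b' b ℂ) (ρ : Matrix (a × b) (a × b) ℂ) :
    tensorMap (krausMap K) (krausMap L) ρ =
      ∑ i, ∑ j, (K i ⊗ₖ L j) * ρ * (K i ⊗ₖ L j)ᴴ := by
  classical
  have h : tensorMap (krausMap K) (krausMap L) =
      krausMap fun p : ι × κ => K p.1 ⊗ₖ L p.2 := by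
    refine Matrix.ext_linearMap ℂ fun p q => LinearMap.ext fun z => ?_
    obtain ⟨p₁, p₂⟩ := p
    obtain ⟨q₁, q₂⟩ := q
    have hz : Matrix.singleLinearMap ℂ (p₁, p₂) (q₁, q₂) z =
        Matrix.single p₁ q₁ z ⊗ₖ Matrix.single p₂ q₂ (1 : ℂ) := by
      rw [Matrix.single_kronecker_single, mul_one]
      rfl
    simp only [LinearMap.comp_apply]
    rw [hz, tensorMap_kronecker]
    simp only [krausMap, LinearMap.coe_mk, AddHom.coe_mk, Matrix.conjTranspose_kronecker,
      ← Matrix.mul_kronecker_mul, Fintype.sum_prod_type]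
    ext ⟨s, t⟩ ⟨s', t'⟩
    simp only [Matrix.kroneckerMap_apply, Matrix.sum_apply, Finset.sum_mul_sum]
  rw [h]
  exact Fintype.sum_prod_type _

theorem isQuantumOperation_krausMap {ι a b : Type} [Fintype ι] [Fintype a] [Fintype b]
    [DecidableEq a] {K : ι → Matrix b a ℂ} (hK : ∑ i, (K i)ᴴ * K i = 1) :
    IsQuantumOperation (krausMap K) where
  completelyPositive r ρ hρ := by
    have hid : (LinearMap.id : Matrix (Fin r) (Fin r) ℂ →ₗ[ℂ] Matrix (Fin r) (Fin r) ℂ) =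
        krausMap fun _ : Unit => 1 := by
      ext ρ : 1
      simp [krausMap]
    rw [hid, tensorMap_krausMap]
    exact Matrix.posSemidef_sum _ fun _ _ => Matrix.posSemidef_sum _ fun _ _ =>
      hρ.mul_mul_conjTranspose_same _
  tracePreserving ρ := by
    simp only [krausMap, LinearMap.coe_mk, AddHom.coe_mk, Matrix.trace_sum]
    have : ∀ i, (K i * ρ * (K i)ᴴ).trace = ((K i)ᴴ * K i * ρ).trace := fun i => by
      rw [Matrix.trace_mul_comm, Matrix.mul_assoc]
    simp only [this]
    rw [← Matrix.trace_sum, ← Matrix.sum_mul, hK, Matrix.one_mul]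

/-- Up to the factor 2^(-k/2), this is the unnormalised state shared in a scheme with a register of
size 2^k. -/
theorem eprPairs_eq (k : ℕ) (p : Qubits (Fin k) × Qubits (Fin k)) :
    eprPairs k p = if p.1 = p.2 then (((Real.sqrt 2 : ℝ) : ℂ)⁻¹) ^ k else 0 := by
  unfold eprPairs eprPair
  split_ifs with h
  · simp [h]
  · obtain ⟨i, hi⟩ := Function.ne_iff.1 h
    exact Finset.prod_eq_zero (Finset.mem_univ i) (if_neg hi)

theorem eprPairs_unit (k : ℕ) : ∑ p, ‖eprPairs k p‖ ^ 2 = 1 := by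
  simp only [eprPairs_eq, Fintype.sum_prod_type]
  have h : ∀ x y : Qubits (Fin k), ‖if x = y then (((Real.sqrt 2 : ℝ) : ℂ)⁻¹) ^ k else 0‖ ^ 2 =
      if x = y then ((2 : ℝ) ^ k)⁻¹ else 0 := by
    intro x y
    split_ifs
    · rw [norm_pow, norm_inv, Complex.norm_real, Real.norm_of_nonneg (Real.sqrt_nonneg 2),
        ← pow_mul, mul_comm, pow_mul, inv_pow, Real.sq_sqrt (by norm_num), inv_pow]
    · simp
  simp only [h, Finset.sum_ite_eq, Finset.mem_univ, if_true, Finset.sum_const, Finset.card_univ]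
  simp

/-! ### From schemes to protocols -/

namespace Scheme

/-- Both completeness relations force the two copies of the shared index to agree, which leaves one
term for each basis state. This normalises the outcome probabilities later. -/
theorem sum_amp_conjTranspose_mul {A B R : Type} [Fintype A] [Fintype B] [Fintype R]
    [DecidableEq A] [DecidableEq B] (S : Scheme A B R) :
    ∑ x, ∑ y, (S.amp x y)ᴴ * S.amp x y = (Fintype.card S.E : ℂ) • 1 := by
  ext ⟨a, b⟩ ⟨a', b'⟩
  have hK := sum_conjTranspose_mul_eq_one_iff.1 S.complete_K
  have h1 : ∀ x y r, star (S.amp x y r (a, b)) * S.amp x y r (a', b') = ∑ e, ∑ e',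
      (star (S.K x r (a, e)) * S.K x r (a', e')) * (star (S.L y (b, e)) * S.L y (b', e')) := by
    intro x y r
    simp only [amp, Matrix.of_apply, star_sum, Finset.sum_mul_sum]
    refine Finset.sum_congr rfl fun e _ => Finset.sum_congr rfl fun e' _ => ?_
    rw [star_mul']
    ring
  have h2 : ∑ x, ∑ y, ∑ r, ∑ e, ∑ e',
      (star (S.K x r (a, e)) * S.K x r (a', e')) * (star (S.L y (b, e)) * S.L y (b', e')) =
      ∑ e, ∑ e', (∑ x, ∑ r, star (S.K x r (a, e)) * S.K x r (a', e')) *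
        (∑ y, star (S.L y (b, e)) * S.L y (b', e')) := by
    have comm : ∀ F : S.X → S.Y → R → S.E → S.E → ℂ,
        ∑ x, ∑ y, ∑ r, ∑ e, ∑ e', F x y r e e' = ∑ e, ∑ e', ∑ x, ∑ y, ∑ r, F x y r e e' := by
      intro F
      calc _ = ∑ t : S.X × S.Y × R, ∑ p : S.E × S.E, F t.1 t.2.1 t.2.2 p.1 p.2 := by
            simp only [Fintype.sum_prod_type]
        _ = ∑ p : S.E × S.E, ∑ t : S.X × S.Y × R, F t.1 t.2.1 t.2.2 p.1 p.2 := Finset.sum_comm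
        _ = _ := by simp only [Fintype.sum_prod_type]
    rw [comm]
    simp only [Finset.sum_mul_sum]
    simp only [Finset.sum_mul]
  simp only [Matrix.sum_apply, Matrix.mul_apply, Matrix.conjTranspose_apply, h1, h2, hK,
    S.complete_L, Matrix.smul_apply, Matrix.one_apply, Prod.mk.injEq, smul_eq_mul]
  by_cases h : a = a' ∧ b = b'
  · obtain ⟨rfl, rfl⟩ := h
    simp
  · rw [if_neg h, mul_zero]
    refine Finset.sum_eq_zero fun e _ => Finset.sum_eq_zero fun e' _ => ?_
    by_cases ha : a = a'
    · rw [if_neg (fun hb => h ⟨ha, hb.1⟩ : ¬ (b = b' ∧ e = e')), mul_zero]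
    · rw [if_neg (fun hb => ha hb.1 : ¬ (a = a' ∧ e = e')), zero_mul]


/-! ### The protocol attached to a scheme -/

section protocol

variable {m k : ℕ}
  (S : Scheme (Qubits (Fin m)) (Qubits (Fin m)) (Qubits (Fin m ⊕ Fin m)))
  (key : S.X → S.Y → Fin m ⊕ Fin m → Fin 2 × Fin 2) (e : S.E ≃ Qubits (Fin k))

open scoped Classical in
/-- Alice's first step: she keeps her qubits and sends Bob's, each with a copy of her outcome. -/
noncomputable def aliceFirst : Matrix ((S.X × Qubits (Fin m)) × (S.X × Qubits (Fin m)))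
    (Qubits (Fin m) × Qubits (Fin k)) ℂ :=
  Matrix.of fun p q => if p.1.1 = p.2.1 then
    S.K p.1.1 (Sum.elim p.1.2 p.2.2) (q.1, e.symm q.2) else 0

open scoped Classical in
/-- Bob's first step: he keeps his outcome and sends a copy. -/
noncomputable def bobFirst : Matrix (S.Y × S.Y) (Qubits (Fin m) × Qubits (Fin k)) ℂ :=
  Matrix.of fun p q => if p.1 = p.2 then S.L p.1 (q.1, e.symm q.2) else 0

open scoped Classical in
/-- Alice's second step: she reads the outcomes and corrects the Pauli error. -/
noncomputable def aliceSecond (i : S.X × S.Y) :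
    Matrix (Qubits (Fin m)) ((S.X × Qubits (Fin m)) × S.Y) ℂ :=
  Matrix.of fun q p => if (p.1.1, p.2) = i then (pauliOn (key i.1 i.2 ∘ Sum.inl))ᴴ q p.1.2 else 0

open scoped Classical in
/-- Bob's second step: he reads the outcomes and corrects the Pauli error. -/
noncomputable def bobSecond (i : S.X × S.Y) :
    Matrix (Qubits (Fin m)) (S.Y × (S.X × Qubits (Fin m))) ℂ :=
  Matrix.of fun q p => if (p.2.1, p.1) = i then (pauliOn (key i.1 i.2 ∘ Sum.inr))ᴴ q p.2.2 else 0

theorem aliceFirst_conjTranspose_mul : (aliceFirst S e)ᴴ * aliceFirst S e = 1 := by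
  classical
  ext ⟨a, p⟩ ⟨a', p'⟩
  have h := sum_conjTranspose_mul_eq_one_iff.1 S.complete_K (a, e.symm p) (a', e.symm p')
  rw [Matrix.mul_apply]
  simp only [aliceFirst, Matrix.conjTranspose_apply, Matrix.of_apply, Fintype.sum_prod_type,
    apply_ite star, star_zero, ite_mul, zero_mul, mul_ite, mul_zero]
  have h2 : ∀ x, ∑ r, star (S.K x r (a, e.symm p)) * S.K x r (a', e.symm p') =
      ∑ q₁, ∑ q₂, star (S.K x (Sum.elim q₁ q₂) (a, e.symm p)) *
        S.K x (Sum.elim q₁ q₂) (a', e.symm p') := by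
    intro x
    rw [← Fintype.sum_prod_type' fun q₁ q₂ => star (S.K x (Sum.elim q₁ q₂) (a, e.symm p)) *
        S.K x (Sum.elim q₁ q₂) (a', e.symm p')]
    exact Fintype.sum_equiv (Equiv.sumArrowEquivProdArrow _ _ _) _ _ fun r => by
      simp [Equiv.sumArrowEquivProdArrow]
  simp only [h2, Prod.mk.injEq, EmbeddingLike.apply_eq_iff_eq] at h
  rw [Matrix.one_apply]
  simp only [Prod.mk.injEq]
  rw [← h]
  refine Finset.sum_congr rfl fun x _ => Finset.sum_congr rfl fun q₁ _ => ?_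
  rw [Finset.sum_comm]
  refine Finset.sum_congr rfl fun q₂ _ => ?_
  simp

theorem bobFirst_conjTranspose_mul : (bobFirst S e)ᴴ * bobFirst S e = 1 := by
  classical
  ext ⟨b, p⟩ ⟨b', p'⟩
  have h := S.complete_L (b, e.symm p) (b', e.symm p')
  rw [Matrix.mul_apply]
  simp only [bobFirst, Matrix.conjTranspose_apply, Matrix.of_apply, Fintype.sum_prod_type,
    apply_ite star, star_zero, ite_mul, zero_mul, mul_ite, mul_zero]
  simp only [Prod.mk.injEq, EmbeddingLike.apply_eq_iff_eq] at h
  rw [Matrix.one_apply]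
  simp only [Prod.mk.injEq]
  rw [← h]
  exact Finset.sum_congr rfl fun y _ => by simp

/-- Measuring a control register and then applying the unitary it selects is a complete measurement.
-/
theorem sum_conjTranspose_mul_of_controlled {D I Q : Type} [Fintype I] [Fintype Q]
    [DecidableEq D] [DecidableEq I] [DecidableEq Q] (U : I → Matrix Q Q ℂ)
    (hU : ∀ i, (U i)ᴴ * U i = 1) (f : D ≃ I × Q) :
    ∑ i, (Matrix.of fun q d => if (f d).1 = i then (U i) q (f d).2 else 0 : Matrix Q D ℂ)ᴴ *
      (Matrix.of fun q d => if (f d).1 = i then (U i) q (f d).2 else 0) = 1 := by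
  rw [sum_conjTranspose_mul_eq_one_iff]
  intro d d'
  have h : ∀ i, ∑ q, star (U i q (f d).2) * U i q (f d').2 =
      if (f d).2 = (f d').2 then 1 else 0 := by
    intro i
    have := congrFun (congrFun (hU i) (f d).2) (f d').2
    rwa [Matrix.mul_apply, Matrix.one_apply] at this
  simp only [Matrix.of_apply, apply_ite star, star_zero, ite_mul, zero_mul, mul_ite, mul_zero]
  rw [Finset.sum_eq_single (f d).1 (fun i _ hi => by simp [hi.symm]) (by simp)]
  simp only [if_true]
  by_cases h1 : (f d').1 = (f d).1
  · simp only [h1, if_true, h]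
    exact if_congr ⟨fun h2 => f.injective (Prod.ext h1.symm h2), fun h2 => by rw [h2]⟩ rfl rfl
  · simp only [h1, if_false, Finset.sum_const_zero]
    rw [if_neg fun h2 => h1 (by rw [h2])]

theorem pauliOn_mul_conjTranspose {Λ : Type} [Fintype Λ] [DecidableEq Λ]
    (p : Λ → Fin 2 × Fin 2) : (pauliOn p)ᴴᴴ * (pauliOn p)ᴴ = 1 := by
  rw [Matrix.conjTranspose_conjTranspose]
  exact mul_eq_one_comm.1 (pauliOn_conjTranspose_mul p)

open scoped Classical in
theorem sum_aliceSecond :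
    ∑ i, (aliceSecond S key i)ᴴ * aliceSecond S key i = 1 :=
  sum_conjTranspose_mul_of_controlled
    (fun i : S.X × S.Y => (pauliOn (key i.1 i.2 ∘ Sum.inl))ᴴ)
    (fun _ => pauliOn_mul_conjTranspose _)
    (⟨fun p => ((p.1.1, p.2), p.1.2), fun p => ((p.1.1, p.2), p.1.2), fun _ => rfl,
      fun _ => rfl⟩ : (S.X × Qubits (Fin m)) × S.Y ≃ (S.X × S.Y) × Qubits (Fin m))

open scoped Classical in
theorem sum_bobSecond :
    ∑ i, (bobSecond S key i)ᴴ * bobSecond S key i = 1 :=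
  sum_conjTranspose_mul_of_controlled
    (fun i : S.X × S.Y => (pauliOn (key i.1 i.2 ∘ Sum.inr))ᴴ)
    (fun _ => pauliOn_mul_conjTranspose _)
    (⟨fun p => ((p.2.1, p.1), p.2.2), fun p => (p.1.2, (p.1.1, p.2)), fun _ => rfl,
      fun _ => rfl⟩ : S.Y × (S.X × Qubits (Fin m)) ≃ (S.X × S.Y) × Qubits (Fin m))

/-- The protocol in which Alice performs the scheme, sends Bob's qubits back, and both players
correct the Pauli error given by `key`. -/
noncomputable def toProtocol :
    INQCProtocol k (Qubits (Fin m)) (Qubits (Fin m)) (Qubits (Fin m)) (Qubits (Fin m)) where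
  resource := eprPairs k
  resource_unit := eprPairs_unit k
  Am := S.X × Qubits (Fin m)
  As := S.X × Qubits (Fin m)
  Bm := S.Y
  Bs := S.Y
  A₁ := krausMap fun _ : Unit => aliceFirst S e
  B₁ := krausMap fun _ : Unit => bobFirst S e
  A₂ := krausMap (aliceSecond S key)
  B₂ := krausMap (bobSecond S key)
  isQuantumOperation_A₁ := by
    classical
    exact isQuantumOperation_krausMap (by simpa using aliceFirst_conjTranspose_mul S e)
  isQuantumOperation_B₁ := by
    classical
    exact isQuantumOperation_krausMap (by simpa using bobFirst_conjTranspose_mul S e)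
  isQuantumOperation_A₂ := by
    classical
    exact isQuantumOperation_krausMap (sum_aliceSecond S key)
  isQuantumOperation_B₂ := by
    classical
    exact isQuantumOperation_krausMap (sum_bobSecond S key)

/-- The isometry that adjoins `k` EPR pairs to the input. -/
noncomputable def adjoinPairs (m k : ℕ) :
    Matrix ((Qubits (Fin m) × Qubits (Fin k)) × (Qubits (Fin m) × Qubits (Fin k)))
      (Qubits (Fin m) × Qubits (Fin m)) ℂ :=
  Matrix.of fun p q => if (p.1.1, p.2.1) = q then eprPairs k (p.1.2, p.2.2) else 0

/-- The operator applied to the input when the players find the outcomes `i` and `j`. -/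
noncomputable def protocolKraus (i j : S.X × S.Y) :
    Matrix (Qubits (Fin m) × Qubits (Fin m)) (Qubits (Fin m) × Qubits (Fin m)) ℂ :=
  (aliceSecond S key i ⊗ₖ bobSecond S key j) *
    ((aliceFirst S e ⊗ₖ bobFirst S e) * adjoinPairs m k).submatrix
      (fun p : ((S.X × Qubits (Fin m)) × S.Y) × (S.Y × (S.X × Qubits (Fin m))) =>
        ((p.1.1, p.2.2), (p.2.1, p.1.2))) id

/-- Adjoining the pairs, the first operations and the exchange of registers each multiply the state
by a matrix on the left and by its adjoint on the right; the second operations then sum over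
outcomes. -/
theorem toProtocol_output (ρ : Matrix (Qubits (Fin m) × Qubits (Fin m))
    (Qubits (Fin m) × Qubits (Fin m)) ℂ) :
    (toProtocol S key e).output ρ =
      ∑ i, ∑ j, protocolKraus S key e i j * ρ * (protocolKraus S key e i j)ᴴ := by
  have hstart : (ρ ⊗ₖ Matrix.vecMulVec (eprPairs k) (star (eprPairs k))).submatrix
      (fun p : (Qubits (Fin m) × Qubits (Fin k)) × (Qubits (Fin m) × Qubits (Fin k)) =>
        ((p.1.1, p.2.1), (p.1.2, p.2.2)))
      (fun p : (Qubits (Fin m) × Qubits (Fin k)) × (Qubits (Fin m) × Qubits (Fin k)) =>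
        ((p.1.1, p.2.1), (p.1.2, p.2.2))) =
      adjoinPairs m k * ρ * (adjoinPairs m k)ᴴ := by
    ext p q
    have h1 : ∀ s, (adjoinPairs m k * ρ) p s = eprPairs k (p.1.2, p.2.2) * ρ (p.1.1, p.2.1) s := by
      intro s
      simp [Matrix.mul_apply, adjoinPairs]
    rw [Matrix.mul_apply]
    simp only [h1]
    simp only [adjoinPairs, Matrix.conjTranspose_apply, Matrix.of_apply, apply_ite star, star_zero,
      mul_ite, mul_zero, Finset.sum_ite_eq, Finset.mem_univ, if_true, Matrix.submatrix_apply,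
      Matrix.kroneckerMap_apply, Matrix.vecMulVec_apply, Pi.star_apply]
    ring
  have hsub : ∀ {I J K : Type} [Fintype J] (M : Matrix I J ℂ) (σ : Matrix J J ℂ) (g : K → I),
      (M * σ * Mᴴ).submatrix g g = M.submatrix g id * σ * (M.submatrix g id)ᴴ := by
    intro I J K _ M σ g
    ext a b
    simp [Matrix.mul_apply]
  have hfirst : tensorMap (krausMap fun _ : Unit => aliceFirst S e)
      (krausMap fun _ : Unit => bobFirst S e) (adjoinPairs m k * ρ * (adjoinPairs m k)ᴴ) =
      ((aliceFirst S e ⊗ₖ bobFirst S e) * adjoinPairs m k) * ρ *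
        ((aliceFirst S e ⊗ₖ bobFirst S e) * adjoinPairs m k)ᴴ := by
    rw [tensorMap_krausMap]
    simp only [Finset.univ_unique, Finset.sum_singleton]
    rw [Matrix.conjTranspose_mul _ (adjoinPairs m k)]
    simp only [Matrix.mul_assoc]
  change tensorMap (krausMap (aliceSecond S key)) (krausMap (bobSecond S key))
    ((tensorMap (krausMap fun _ : Unit => aliceFirst S e) (krausMap fun _ : Unit => bobFirst S e)
      ((ρ ⊗ₖ Matrix.vecMulVec (eprPairs k) (star (eprPairs k))).submatrix _ _)).submatrix
        (fun p : ((S.X × Qubits (Fin m)) × S.Y) × (S.Y × (S.X × Qubits (Fin m))) =>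
          ((p.1.1, p.2.2), (p.2.1, p.1.2)))
        (fun p : ((S.X × Qubits (Fin m)) × S.Y) × (S.Y × (S.X × Qubits (Fin m))) =>
          ((p.1.1, p.2.2), (p.2.1, p.1.2)))) = _
  rw [hstart, hfirst, hsub, tensorMap_krausMap]
  refine Finset.sum_congr rfl fun i _ => Finset.sum_congr rfl fun j _ => ?_
  rw [protocolKraus, Matrix.conjTranspose_mul (aliceSecond S key i ⊗ₖ bobSecond S key j)]
  simp only [Matrix.mul_assoc]

-- Both players hold copies of the same outcomes, so their readings agree. The two local corrections
-- then combine to the inverse of the whole key.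
open scoped Classical in
theorem protocolKraus_apply (i j : S.X × S.Y) (q p : Qubits (Fin m) × Qubits (Fin m)) :
    protocolKraus S key e i j q p = if i = j then (((Real.sqrt 2 : ℝ) : ℂ)⁻¹) ^ k *
      ∑ s, (pauliOn (key i.1 i.2))ᴴ (Sum.elim q.1 q.2) s * S.amp i.1 i.2 s p else 0 := by
  obtain ⟨x, y⟩ := i
  obtain ⟨x', y'⟩ := j
  obtain ⟨qa, qb⟩ := q
  obtain ⟨a, b⟩ := p
  have h1 : ∀ am as bm bs, ((aliceFirst S e ⊗ₖ bobFirst S e) * adjoinPairs m k)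
      ((am, as), (bm, bs)) (a, b) = if am.1 = as.1 then if bm = bs then
        (((Real.sqrt 2 : ℝ) : ℂ)⁻¹) ^ k * S.amp am.1 bm (Sum.elim am.2 as.2) (a, b)
        else 0 else 0 := by
    intro am as bm bs
    have h2 : S.amp am.1 bm (Sum.elim am.2 as.2) (a, b) = ∑ p : Qubits (Fin k),
        S.K am.1 (Sum.elim am.2 as.2) (a, e.symm p) * S.L bm (b, e.symm p) :=
      (Equiv.sum_comp e.symm fun t => S.K am.1 (Sum.elim am.2 as.2) (a, t) * S.L bm (b, t)).symm
    rw [Matrix.mul_apply, h2, Finset.mul_sum]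
    simp only [adjoinPairs, Matrix.kroneckerMap_apply, Matrix.of_apply, Fintype.sum_prod_type,
      Prod.mk.injEq, ite_and, mul_ite, mul_zero, eprPairs_eq, Finset.sum_ite_irrel,
      Finset.sum_const_zero, Finset.sum_ite_eq, Finset.sum_ite_eq', Finset.mem_univ, if_true,
      aliceFirst, bobFirst, ite_mul, zero_mul]
    split_ifs
    · exact Finset.sum_congr rfl fun _ _ => mul_comm _ _
    all_goals rfl
  rw [protocolKraus, Matrix.mul_apply]
  simp only [Fintype.sum_prod_type, Matrix.submatrix_apply, id_eq, h1, Matrix.kroneckerMap_apply,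
    aliceSecond, bobSecond, Matrix.of_apply, Prod.mk.injEq, ite_and, ite_mul, zero_mul, mul_ite,
    mul_zero, Finset.sum_ite_irrel,
    Finset.sum_const_zero, Finset.sum_ite_eq, Finset.sum_ite_eq', Finset.mem_univ, if_true]
  by_cases hx : x = x'
  swap
  · rw [if_neg hx, if_neg (Ne.symm hx)]
  by_cases hy : y = y'
  swap
  · simp only [if_neg hy, if_neg (Ne.symm hy), ite_self]
  subst hx hy
  simp only [if_true]
  rw [Finset.mul_sum, ← Fintype.sum_prod_type' fun q₁ q₂ =>
    (pauliOn (key x y ∘ Sum.inl))ᴴ qa q₁ * (pauliOn (key x y ∘ Sum.inr))ᴴ qb q₂ *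
      ((((Real.sqrt 2 : ℝ) : ℂ)⁻¹) ^ k * S.amp x y (Sum.elim q₁ q₂) (a, b))]
  refine (Fintype.sum_equiv (Equiv.sumArrowEquivProdArrow _ _ _) _ _ fun s => ?_).symm
  simp only [Matrix.conjTranspose_apply, pauliOn_sum (key x y), star_mul']
  have hs : Sum.elim (s ∘ Sum.inl) (s ∘ Sum.inr) = s := Sum.elim_comp_inl_inr s
  change _ = _ * (_ * S.amp x y (Sum.elim (s ∘ Sum.inl) (s ∘ Sum.inr)) (a, b))
  rw [hs, mul_left_comm]
  rfl

theorem toProtocol_performs {C : Circuit (Fin m ⊕ Fin m)}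
    (hS : S.Realizes key (C.unitary * inputMap m)) :
    (toProtocol S key e).Performs C.bipartiteMap := by
  classical
  intro ρ
  choose c hc using hS
  let U : Matrix (Qubits (Fin m) × Qubits (Fin m)) (Qubits (Fin m) × Qubits (Fin m)) ℂ :=
    C.unitary.submatrix (fun p => Sum.elim p.1 p.2) (fun p => Sum.elim p.1 p.2)
  let r : ℂ := (((Real.sqrt 2 : ℝ) : ℂ)⁻¹) ^ k
  have hJ : (inputMap m)ᴴ * inputMap m = 1 := basisMap_conjTranspose_mul fun p q h =>
    Prod.ext (funext fun i => congrFun h (Sum.inl i)) (funext fun i => congrFun h (Sum.inr i))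
  have hkraus : ∀ i j, protocolKraus S key e i j = if i = j then (r * c i.1 i.2) • U else 0 := by
    intro i j
    ext q p
    rw [protocolKraus_apply]
    split_ifs
    swap
    · rfl
    have h1 : ∑ s, (pauliOn (key i.1 i.2))ᴴ (Sum.elim q.1 q.2) s * S.amp i.1 i.2 s p =
        ((pauliOn (key i.1 i.2))ᴴ * S.amp i.1 i.2) (Sum.elim q.1 q.2) p :=
      (Matrix.mul_apply ..).symm
    have h2 : (C.unitary * inputMap m) (Sum.elim q.1 q.2) p = U q p := by
      rw [Matrix.mul_apply]
      simp [inputMap, basisMap, U]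
    rw [h1, hc, Matrix.mul_smul, ← Matrix.mul_assoc, pauliOn_conjTranspose_mul, Matrix.one_mul,
      Matrix.smul_apply, h2, Matrix.smul_apply, smul_eq_mul, smul_eq_mul, mul_assoc]
  have hcard : (Fintype.card S.E : ℂ) = 2 ^ k := by
    rw [Fintype.card_congr e]
    simp
  -- The individual scalars are unknown. Since the key, the circuit and the input map are all
  -- isometries, completeness still determines the sum of their squared moduli.
  have hsum : ∑ x, ∑ y, star (c x y) * c x y = 2 ^ k := by
    have h := S.sum_amp_conjTranspose_mul
    have h1 : ∀ x y, (S.amp x y)ᴴ * S.amp x y = (star (c x y) * c x y) • 1 := by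
      intro x y
      rw [hc, Matrix.conjTranspose_smul, Matrix.smul_mul, Matrix.mul_smul, smul_smul,
        Matrix.conjTranspose_mul (pauliOn _), Matrix.mul_assoc, ← Matrix.mul_assoc (pauliOn _)ᴴ,
        pauliOn_conjTranspose_mul, Matrix.one_mul, Matrix.conjTranspose_mul C.unitary,
        Matrix.mul_assoc, ← Matrix.mul_assoc C.unitaryᴴ, C.unitary_conjTranspose_mul,
        Matrix.one_mul, hJ]
    have h2 := congrFun (congrFun h (0, 0)) (0, 0)
    simp only [h1, Matrix.sum_apply, Matrix.smul_apply, Matrix.one_apply_eq, smul_eq_mul, mul_one,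
      hcard] at h2
    exact h2
  have hr : star r * r * 2 ^ k = 1 := by
    have h2 : ((Real.sqrt 2 : ℝ) : ℂ) ^ 2 = 2 := by
      rw [← Complex.ofReal_pow, Real.sq_sqrt (by norm_num)]
      norm_num
    have h3 : star r = r := by simp [r, Complex.conj_ofReal]
    rw [h3, ← mul_pow, ← mul_pow, ← sq, inv_pow, h2]
    norm_num
  have hbip : C.bipartiteMap ρ = U * ρ * Uᴴ := rfl
  rw [toProtocol_output, hbip]
  have h1 : ∀ i : S.X × S.Y, ∑ j, protocolKraus S key e i j * ρ * (protocolKraus S key e i j)ᴴ =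
      (star r * r * (star (c i.1 i.2) * c i.1 i.2)) • (U * ρ * Uᴴ) := by
    intro i
    rw [Finset.sum_eq_single i (fun j _ hj => by simp [hkraus, Ne.symm hj]) (by simp), hkraus,
      if_pos rfl, Matrix.conjTranspose_smul, Matrix.smul_mul, Matrix.smul_mul, Matrix.mul_smul,
      smul_smul, star_mul']
    congr 1
    ring
  simp only [h1]
  rw [← Finset.sum_smul, ← Finset.mul_sum, Fintype.sum_prod_type, hsum, hr, one_smul]

end protocol

end Scheme

theorem theorem5 :
    ∃ c : ℕ, ∀ (n m d : ℕ), n = 2 * m → 1 ≤ d →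
      ∀ C : Circuit (Fin m ⊕ Fin m), C.tDepth = d →
        (∃ k : ℕ, k ≤ c * (68 * n) ^ d ∧
          ∃ P : INQCProtocol k (Qubits (Fin m)) (Qubits (Fin m)) (Qubits (Fin m)) (Qubits (Fin m)),
            P.resource = eprPairs k ∧ P.Performs C.bipartiteMap) ∧
        INQC C.bipartiteMap ≤ ((c * (68 * n) ^ d : ℕ) : ℕ∞) := by
  refine ⟨1, fun n m d hn hd C hC => ?_⟩
  -- An empty set would give the default infimum 0, against d ≥ 1; hence the T-depth is attained by
  -- a layered form.
  have hne : {d | ∃ C' : Circuit (Fin m ⊕ Fin m),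
      Circuit.Same C C' ∧ Circuit.HasLayers d C'}.Nonempty := by
    by_contra h
    rw [Set.not_nonempty_iff_eq_empty] at h
    rw [Circuit.tDepth, h, Nat.sInf_empty] at hC
    omega
  obtain ⟨C', hsame, hlayers⟩ := Nat.sInf_mem hne
  rw [Circuit.tDepth] at hC
  rw [hC] at hlayers
  obtain ⟨S, key, k, Λ, _, hk, hcard, -, hS, -⟩ := Scheme.exists_realizes hlayers
  rw [← hsame.unitary_eq] at hS
  have hk' : k ≤ 1 * (68 * n) ^ d := by
    rw [one_mul, hn]
    exact hk.trans (Scheme.pairs_le m hd)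
  have e : S.E ≃ Qubits (Fin k) := Fintype.equivOfCardEq (by rw [hcard]; simp)
  have hP := Scheme.toProtocol_performs S key e hS
  exact ⟨⟨k, hk', Scheme.toProtocol S key e, rfl, hP⟩,
    iInf₂_le_of_le k ⟨_, hP⟩ (by exact_mod_cast hk')⟩
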